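/- **Conventions.** Let $p$ be a prime and $S$ a finite $p$-group. A *fusion system* $\mathcal F$ over $S$ is a category whose objects are the subgroups of $S$, whose morphism sets satisfy $\mathrm{Hom}_S(P,Q)\subseteq \mathrm{Hom}_{\mathcal F}(P,Q)\subseteq \mathrm{Inj}(P,Q)$, where $\mathrm{Hom}_S(P,Q)$ is the set of conjugations $x\mapsto gxg^{-1}$ with $g\in S$ and $gPg^{-1}\le Q$, and in which each morphism is an $\mathcal F$-isomorphism followed by an inclusion. For $P\le S$, $P^{\mathcal F}$ is the set of subgroups of $S$ that are $\mathcal F$-isomorphic to $P$. For $x\in S$, $x^{\mathcal F}$ is the set of $y\in S$ such that $\varphi(x)=y$ for some $\varphi\in\mathrm{Hom}_{\mathcal F}(\langle x\rangle,\langle y\rangle)$. A subgroup $P\le S$ is * *fully normalized* (*fully centralized*) in $\mathcal F$ if $|N_S(P)|\ge|N_S(Q)|$ (respectively $|C_S(P)|\ge|C_S(Q)|$) for all $Q\in P^{\mathcal F}$; * *weakly closed* in $\mathcal F$ if $P^{\mathcal F}=\{P\}$; * *normal* in $\mathcal F$ ($P\trianglelefteq\mathcal F$) if each morphism of $\mathcal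 F$ extends to a morphism of $\mathcal F$ that sends $P$ to itself. $\mathcal F$ is *saturated* if (i) each fully normalized $P\le S$ is fully centralized and satisfies $\mathrm{Aut}_S(P)\in\mathrm{Syl}_p(\mathrm{Aut}_{\mathcal F}(P))$; and (ii) each $\varphi\in\mathrm{Iso}_{\mathcal F}(P,Q)$ with $Q$ fully centralized extends to a morphism in $\mathrm{Hom}_{\mathcal F}(N_\varphi,S)$, where $N_\varphi=\{g\in N_S(P)\mid \varphi c_g\varphi^{-1}\in\mathrm{Aut}_S(Q)\}$ and $c_g$ is conjugation by $g$ on $P$. For $Q\le S$, $C_{\mathcal F}(Q)$ is the fusion system over $C_S(Q)$ with $\mathrm{Hom}_{C_{\mathcal F}(Q)}(P,R)=\{\varphi|_P\mid\varphi\in\mathrm{Hom}_{\mathcal F}(PQ,RQ),\ \varphi(P)\le R,\ \varphi|_Q=\mathrm{Id}_Q\}$. **Proposition 2.2.** Let $\mathcal F$ be a saturated fusion system over a finite $p$-group $S$, and let $A\le S$ be an abelian subgroup with $A\not\trianglelefteq\mathcal F$. For a fusion system $\mathcal E$ over a $p$-group $R\le S$ with $A\le R$ set $$\mathscr U_{\mathcal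 E}(A)=\{1\ne U\le N_R(A)\mid U\nleq A,\ \mathrm{Hom}_{\mathcal E}(U,A)\neq\emptyset\},$$ $$\mathscr T_{\mathcal E}(A)=\{t\in N_R(A)\smallsetminus A\mid t^{\mathcal E}\cap A\ne\emptyset\},$$ $$\mathscr W_{\mathcal E}(A)=\{(t,U,A_*)\mid t\in\mathscr T_{\mathcal E}(A),\ U\in\mathscr U_{\mathcal E}(A),\ A_*\le C_A(t),\ A_*\in(U\cap A)^{\mathcal E},\ |UA/A|=|C_{A/A_*}(t)|\},$$ where $C_{A/A_*}(t)$ is the group of cosets in $A/A_*$ fixed under conjugation by $t$, and write $\mathscr U,\mathscr T,\mathscr W$ for these sets when $\mathcal E=\mathcal F$. Then $\mathscr T=\{t\in N_S(A)\smallsetminus A\mid\langle t\rangle\in\mathscr U\}$, the sets $\mathscr U$, $\mathscr T$ and $\mathscr W$ are nonempty, and the following hold. (a) If $A$ is not weakly closed in $\mathcal F$, then there is $U\in A^{\mathcal F}\smallsetminus\{A\}$ such that $[U,A]\le U\cap A$ and $(t,U,U\cap A)\in\mathscr W$ for each $t\in U\smallsetminus A$. (b) If $A$ is weakly closed in $\mathcal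 F$, then for each $t\in\mathscr T$ there are $U\in\mathscr U$ and $A_*\le A$ such that $(t,U,A_*)\in\mathscr W$. (c) If $A$ is weakly closed in $\mathcal F$, then there is a subgroup $Z\le A$, fully centralized in $\mathcal F$, such that $A\not\trianglelefteq C_{\mathcal F}(Z)$ and $U\cap A\le Z$ for each $U\in\mathscr U_{C_{\mathcal F}(Z)}(A)$. In particular, $\mathscr W_{C_{\mathcal F}(Z)}(A)\subseteq\mathscr W_{\mathcal F}(A)$, and $A_*=U\cap A$ for each $(t,U,A_*)\in\mathscr W_{C_{\mathcal F}(Z)}(A)$. Thus in all cases there are $t\in\mathscr T$ and $U\in\mathscr U$ such that $(t,U,U\cap A)\in\mathscr W$. -/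

import Mathlib

/-! Fusion systems over a subgroup `S` of an ambient group `G` (`S = ⊤` is the case of an abstract
group).  Objects are the subgroups of `G` contained in `S`. -/

section

variable {G : Type*} [Group G]

/-- `N_S(P)`. -/
def normalizerIn (S P : Subgroup G) : Subgroup G :=
  S ⊓ Subgroup.normalizer (P : Set G)

/-- `C_S(P)`. -/
def centralizerIn (S P : Subgroup G) : Subgroup G :=
  S ⊓ Subgroup.centralizer (P : Set G)

/-- `Hom_S(P, Q)`: the homomorphisms `P → Q` of the form `x ↦ g x g⁻¹` with `g ∈ S`. -/
def conjHoms (S P Q : Subgroup G) : Set (P →* Q) :=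
  {φ | ∃ g ∈ S, ∀ x : P, (φ x : G) = g * x * g⁻¹}

/-- `Aut_S(P)`: the automorphisms of `P` induced by conjugation by elements of `N_S(P)`. -/
def conjAuts (S P : Subgroup G) : Subgroup (MulAut P) :=
  (S.subgroupOf (Subgroup.normalizer (P : Set G))).map P.normalizerMonoidHom

/-- `N_φ = {g ∈ N_S(P) | φ c_g φ⁻¹ ∈ Aut_S(Q)}`. -/
def extensionSubgroup (S : Subgroup G) {P Q : Subgroup G} (φ : P ≃* Q) : Subgroup G :=
  S ⊓ ((conjAuts S Q).comap
    ((MulAut.congr φ).toMonoidHom.comp P.normalizerMonoidHom)).map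
      (Subgroup.normalizer (P : Set G)).subtype

/-- `ψ : P' → Q'` extends `φ : P → Q`: `P ≤ P'` and `ψ` agrees with `φ` on `P`. -/
def ExtendsHom {P' Q' P Q : Subgroup G} (ψ : P' →* Q') (φ : P →* Q) : Prop :=
  ∃ h : P ≤ P', ∀ x : P, (ψ (Subgroup.inclusion h x) : G) = φ x

/-- A fusion system over `S`: a category whose objects are the subgroups of `S`, whose morphisms
are injective homomorphisms including those of `Hom_S(P, Q)`, and in which every morphism is an
isomorphism of the category followed by an inclusion.  (Identities lie in `Hom_S(P, P)`.) -/
structure FusionSystem (S : Subgroup G) where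
  Hom (P Q : Subgroup G) : Set (P →* Q)
  le_of_mem : ∀ {P Q : Subgroup G} {φ : P →* Q}, φ ∈ Hom P Q → P ≤ S ∧ Q ≤ S
  injective_of_mem : ∀ {P Q : Subgroup G} {φ : P →* Q}, φ ∈ Hom P Q → Function.Injective φ
  comp_mem : ∀ {P Q R : Subgroup G} {φ : P →* Q} {ψ : Q →* R},
    φ ∈ Hom P Q → ψ ∈ Hom Q R → ψ.comp φ ∈ Hom P R
  conjHoms_subset : ∀ {P Q : Subgroup G}, P ≤ S → Q ≤ S → conjHoms S P Q ⊆ Hom P Q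
  factor : ∀ {P Q : Subgroup G} {φ : P →* Q}, φ ∈ Hom P Q →
    ∃ (R : Subgroup G) (hR : R ≤ Q) (ψ : P ≃* R),
      ψ.toMonoidHom ∈ Hom P R ∧ ψ.symm.toMonoidHom ∈ Hom R P ∧
        φ = (Subgroup.inclusion hR).comp ψ.toMonoidHom

namespace FusionSystem

variable {S : Subgroup G} (F : FusionSystem S)

/-- `Iso_F(P, Q)`: the isomorphisms of the category. -/
def Iso (P Q : Subgroup G) : Set (P ≃* Q) :=
  {φ | φ.toMonoidHom ∈ F.Hom P Q ∧ φ.symm.toMonoidHom ∈ F.Hom Q P}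

/-- `Aut_F(P) = Iso_F(P, P)`, as a subgroup of `Aut(P)`. -/
def Aut (P : Subgroup G) (hP : P ≤ S) : Subgroup (MulAut P) where
  carrier := F.Iso P P
  one_mem' :=
    ⟨F.conjHoms_subset hP hP ⟨1, S.one_mem, fun x => by simp⟩,
      F.conjHoms_subset hP hP ⟨1, S.one_mem, fun x => by simp [MulAut.one_def]⟩⟩
  mul_mem' := fun {a b} ha hb => ⟨F.comp_mem hb.1 ha.1, F.comp_mem ha.2 hb.2⟩
  inv_mem' := fun {a} ha => ⟨ha.2, ha.1⟩

/-- `Q ∈ P^F`, that is, `Iso_F(P, Q) ≠ ∅`. -/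
def conjClass (P : Subgroup G) : Set (Subgroup G) :=
  {Q | (F.Iso P Q).Nonempty}

/-- The `F`-conjugacy class `x^F` of an element. -/
def elemConjClass (x : G) : Set G :=
  {y | ∃ φ ∈ F.Hom (Subgroup.zpowers x) (Subgroup.zpowers y),
    (φ ⟨x, Subgroup.mem_zpowers x⟩ : G) = y}

def IsFullyNormalized (P : Subgroup G) : Prop :=
  P ≤ S ∧ ∀ Q ∈ F.conjClass P, Nat.card (normalizerIn S Q) ≤ Nat.card (normalizerIn S P)

def IsFullyCentralized (P : Subgroup G) : Prop :=
  P ≤ S ∧ ∀ Q ∈ F.conjClass P, Nat.card (centralizerIn S Q) ≤ Nat.card (centralizerIn S P)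

/-- Saturation, for a fusion system over a finite `p`-group `S`: the Sylow axiom and the extension
axiom. -/
structure IsSaturated (p : ℕ) : Prop where
  sylow_axiom : ∀ (P : Subgroup G) (hP : P ≤ S), F.IsFullyNormalized P →
    F.IsFullyCentralized P ∧ conjAuts S P ≤ F.Aut P hP ∧
      ∃ T : Sylow p (F.Aut P hP),
        (T : Subgroup (F.Aut P hP)) = (conjAuts S P).subgroupOf (F.Aut P hP)
  extension_axiom : ∀ (P Q : Subgroup G) (φ : P ≃* Q), φ ∈ F.Iso P Q → F.IsFullyCentralized Q →
    ∃ ψ ∈ F.Hom (extensionSubgroup S φ) S, ExtendsHom ψ φ.toMonoidHom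

/-- `P` is weakly closed in `F`: `P^F = {P}`. -/
def IsWeaklyClosed (P : Subgroup G) : Prop :=
  F.conjClass P = {P}

/-- `P` is normal in `F`: each morphism of `F` extends to a morphism that sends `P` to itself. -/
def IsNormal (P : Subgroup G) : Prop :=
  ∀ (Q R : Subgroup G) (φ : Q →* R), φ ∈ F.Hom Q R →
    ∃ (Q' R' : Subgroup G) (ψ : Q' →* R'), ψ ∈ F.Hom Q' R' ∧ ExtendsHom ψ φ ∧
      P ≤ Q' ∧ ((P.subgroupOf Q').map ψ).map R'.subtype = P

/-- The centralizer fusion system `C_F(Q)` over `C_S(Q)`: its morphisms `P → R` are the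
restrictions of the `ψ ∈ Hom_F(PQ, RQ)` that are the identity on `Q` (and send `P` into `R`). -/
def centralizer (Q : Subgroup G) (hQ : Q ≤ S) : FusionSystem (centralizerIn S Q) where
  Hom P R := {φ | P ≤ centralizerIn S Q ∧ R ≤ centralizerIn S Q ∧
    ∃ ψ ∈ F.Hom (P ⊔ Q) (R ⊔ Q), ExtendsHom ψ φ ∧
      ∀ (x : G) (hx : x ∈ Q), (ψ ⟨x, Subgroup.mem_sup_right hx⟩ : G) = x}
  le_of_mem := fun h => ⟨h.1, h.2.1⟩
  injective_of_mem := by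
    rintro P R φ ⟨-, -, ψ, hψ, ⟨hle, h⟩, -⟩ x y hxy
    have h1 : ψ (Subgroup.inclusion hle x) = ψ (Subgroup.inclusion hle y) :=
      Subtype.ext (by rw [h, h, hxy])
    exact Subgroup.inclusion_injective hle (F.injective_of_mem hψ h1)
  comp_mem := by
    rintro P₁ P₂ P₃ φ φ' ⟨h1, -, ψ, hψ, ⟨hle, h⟩, hid⟩ ⟨-, h3, ψ', hψ', ⟨hle', h'⟩, hid'⟩
    refine ⟨h1, h3, ψ'.comp ψ, F.comp_mem hψ hψ', ⟨hle, fun x => ?_⟩, fun x hx => ?_⟩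
    · have : ψ (Subgroup.inclusion hle x) = Subgroup.inclusion hle' (φ x) :=
        Subtype.ext (h x)
      simp only [MonoidHom.comp_apply, this, h']
    · have : ψ ⟨x, Subgroup.mem_sup_right hx⟩ = ⟨x, Subgroup.mem_sup_right hx⟩ :=
        Subtype.ext (hid x hx)
      rw [MonoidHom.comp_apply, this]
      exact hid' x hx
  conjHoms_subset := by
    rintro P R hP hR φ ⟨g, hg, h⟩
    have hgQ : ∀ x ∈ Q, g * x * g⁻¹ = x := fun x hx => by
      rw [← Subgroup.mem_centralizer_iff.mp hg.2 x hx, mul_inv_cancel_right]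
    have hmaps : ∀ y ∈ P ⊔ Q, g * y * g⁻¹ ∈ R ⊔ Q := by
      have hle : P ⊔ Q ≤ (R ⊔ Q).comap (MulAut.conj g).toMonoidHom := by
        refine sup_le (fun x hx => ?_) (fun x hx => ?_)
        · have := h ⟨x, hx⟩
          refine Subgroup.mem_comap.mpr (Subgroup.mem_sup_left ?_)
          simpa [← this] using (φ ⟨x, hx⟩).2
        · refine Subgroup.mem_comap.mpr (Subgroup.mem_sup_right ?_)
          simpa [hgQ x hx] using hx
      intro y hy
      simpa using hle hy
    refine ⟨hP, hR, ((MulAut.conj g).toMonoidHom.comp (P ⊔ Q).subtype).codRestrict (R ⊔ Q)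
      (fun y => hmaps y y.2), ?_, ⟨le_sup_left, fun x => ?_⟩, fun x hx => ?_⟩
    · exact F.conjHoms_subset (sup_le (hP.trans inf_le_left) hQ)
        (sup_le (hR.trans inf_le_left) hQ) ⟨g, hg.1, fun x => by simp⟩
    · simp [h]
    · exact hgQ x hx
  factor := by
    rintro P R φ ⟨hP, hR, ψ, hψ, ⟨hle, h⟩, hid⟩
    have hinj : Function.Injective φ := fun x y hxy =>
      Subgroup.inclusion_injective hle (F.injective_of_mem hψ (Subtype.ext (by rw [h, h, hxy])))
    have hinj' : Function.Injective (R.subtype.comp φ) :=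
      R.subtype_injective.comp hinj
    obtain ⟨T, hT, θ, hθ, hθ', rfl⟩ := F.factor hψ
    have key : T = (R.subtype.comp φ).range ⊔ Q := by
      apply le_antisymm
      · intro t ht
        have hmap : (P ⊔ Q) ≤ (((R.subtype.comp φ).range ⊔ Q).subgroupOf T |>.comap
            θ.toMonoidHom).map (P ⊔ Q).subtype := by
          refine sup_le (fun x hx => ?_) (fun x hx => ?_)
          · refine ⟨⟨x, Subgroup.mem_sup_left hx⟩, ?_, rfl⟩
            refine Subgroup.mem_comap.mpr (Subgroup.mem_subgroupOf.mpr (Subgroup.mem_sup_left ?_))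
            exact ⟨⟨x, hx⟩, (h ⟨x, hx⟩).symm⟩
          · refine ⟨⟨x, Subgroup.mem_sup_right hx⟩, ?_, rfl⟩
            refine Subgroup.mem_comap.mpr (Subgroup.mem_subgroupOf.mpr (Subgroup.mem_sup_right ?_))
            have h2 : ((θ ⟨x, Subgroup.mem_sup_right hx⟩ : T) : G) = x := hid x hx
            change ((θ ⟨x, Subgroup.mem_sup_right hx⟩ : T) : G) ∈ Q
            rwa [h2]
        obtain ⟨y, hy, hy'⟩ := hmap (θ.symm ⟨t, ht⟩).2
        have : y = θ.symm ⟨t, ht⟩ := Subtype.ext hy'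
        subst this
        simpa [Subgroup.mem_subgroupOf] using hy
      · refine sup_le ?_ (fun x hx => ?_)
        · rintro _ ⟨x, rfl⟩
          have h2 : ((θ (Subgroup.inclusion hle x) : T) : G) = φ x := h x
          change (φ x : G) ∈ T
          rw [← h2]
          exact (θ _).2
        · have h2 : ((θ ⟨x, Subgroup.mem_sup_right hx⟩ : T) : G) = x := hid x hx
          rw [← h2]
          exact (θ _).2
    subst key
    have hRle : (R.subtype.comp φ).range ≤ R := by
      rintro _ ⟨x, rfl⟩
      exact (φ x).2
    have hval : ∀ x : P, ((θ (Subgroup.inclusion hle x) : _) : G) = φ x := h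
    have hidθ : ∀ (x : G) (hx : x ∈ Q), θ ⟨x, Subgroup.mem_sup_right hx⟩ =
        ⟨x, Subgroup.mem_sup_right hx⟩ := fun x hx => Subtype.ext (hid x hx)
    refine ⟨(R.subtype.comp φ).range, hRle, MonoidHom.ofInjective hinj',
      ⟨hP, hRle.trans hR, θ.toMonoidHom, hθ, ⟨hle, hval⟩,
        fun x hx => congrArg Subtype.val (hidθ x hx)⟩,
      ⟨hRle.trans hR, hP, θ.symm.toMonoidHom, hθ', ⟨le_sup_left, fun y => ?_⟩,
        fun x hx => ?_⟩, ?_⟩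
    · obtain ⟨x, rfl⟩ := (MonoidHom.ofInjective hinj').surjective y
      have : Subgroup.inclusion le_sup_left (MonoidHom.ofInjective hinj' x) =
          θ (Subgroup.inclusion hle x) := Subtype.ext (hval x).symm
      simp [this]
    · have := congrArg θ.symm (hidθ x hx)
      rw [MulEquiv.symm_apply_apply] at this
      exact (congrArg Subtype.val this).symm
    · ext x
      rfl

/-- `U_F(A) = {1 ≠ U ≤ N_S(A) | U ≰ A, Hom_F(U, A) ≠ ∅}`. -/
def fusingSubgroups (A : Subgroup G) : Set (Subgroup G) :=
  {U | U ≠ ⊥ ∧ U ≤ normalizerIn S A ∧ ¬ U ≤ A ∧ (F.Hom U A).Nonempty}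

/-- `T_F(A) = {t ∈ N_S(A) ∖ A | t^F ∩ A ≠ ∅}`. -/
def fusingElements (A : Subgroup G) : Set G :=
  {t | t ∈ normalizerIn S A ∧ t ∉ A ∧ (F.elemConjClass t ∩ (A : Set G)).Nonempty}

end FusionSystem

/-- `C_{A/B}(t)`: the cosets `aB` in `A/B` fixed by `t`, that is, with `t a t⁻¹ ∈ A` and
`(t a t⁻¹)B = aB`.  Used when `A` is abelian, `B ≤ A`, and `t` normalizes `A` and
centralizes `B`. -/
def fixedCosets (A B : Subgroup G) (t : G) : Set (A ⧸ B.subgroupOf A) :=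
  {c | ∀ a : A, (a : A ⧸ B.subgroupOf A) = c →
    ∃ b : A, (b : G) = t * a * t⁻¹ ∧ (b : A ⧸ B.subgroupOf A) = c}

/-- `W_F(A)`: the triples `(t, U, B)` with `t ∈ T_F(A)`, `U ∈ U_F(A)`, `B ≤ C_A(t)`,
`B ∈ (U ∩ A)^F` and `|UA/A| = |C_{A/B}(t)|`.  Here `UA = U ⊔ A`, since `U` normalizes `A`. -/
def FusionSystem.fusingTriples {S : Subgroup G} (F : FusionSystem S) (A : Subgroup G) :
    Set (G × Subgroup G × Subgroup G) :=
  {w | w.1 ∈ F.fusingElements A ∧ w.2.1 ∈ F.fusingSubgroups A ∧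
    w.2.2 ≤ A ⊓ Subgroup.centralizer {w.1} ∧ w.2.2 ∈ F.conjClass (w.2.1 ⊓ A) ∧
    A.relIndex (w.2.1 ⊔ A) = Nat.card (fixedCosets A w.2.2 w.1)}

end

/-! The starting point is that an abelian subgroup which is strongly closed in a saturated fusion
system is normal (`IsStronglyClosed.isNormal`). So if `A` is weakly closed but not normal, some
morphism carries an `x ∈ A` to an element outside `A`. That element lies in `N_S(A) = S` and is
fused into `A`.

If `A` is not weakly closed, it has a conjugate `U ≠ A` such that `U` and `A` normalize each other
(`IsSaturated.exists_mutually_normalizing`). Then `[U, A] ≤ U ∩ A`, so each `t ∈ U ∖ A` acts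
trivially on `A / (U ∩ A)`, and the required count is just `|U| = |A|`.

If `A` is weakly closed, the main construction is
`IsWeaklyClosed.exists_fusingSubgroups_of_maximal`. Suppose that `P = ⟨t⟩B` is fused into `A`, and
that no larger subgroup fused into `A` meets `A` outside `B`. A morphism on `N_S(P)` sends `P` to a
fully normalized conjugate, which lies in `A`. The group `D` of those `a ∈ A` whose coset in `A / B`
is fixed by `t` normalizes `P`, and its image is the wanted `U`: maximality gives that `U ∩ A` is
the image of `B`, so `|UA/A| = |D/B|`.

Choosing `B` of maximal order for a given `t` proves (b). For (c), choose `Z` of maximal order among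
the fully centralized subgroups of `A` for which `C_F(Z)` still fuses something outside `A` into
`A`. The final statement then applies the construction with `B = Z` and moves `U` so that `U ∩ A`
becomes `Z`. This takes place in `F`, so saturation of `C_F(Z)` is never needed. -/

section

variable {G : Type*} [Group G]

/-! ### Finite group preliminaries. -/

open scoped Pointwise in
/-- In a finite `p`-group, a subgroup `P` normalizing `A` and not containing it is normalized by an
element of `A` outside `P`. -/
theorem exists_mem_normalizer_notMem {p : ℕ} [Fact p.Prime] {S : Subgroup G} [Finite S]
    (hS : IsPGroup p S) {P A : Subgroup G} (hP : P ≤ S) (hA : A ≤ S)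
    (hPA : P ≤ Subgroup.normalizer (A : Set G)) (hAP : ¬ A ≤ P) :
    ∃ a ∈ A, a ∉ P ∧ a ∈ Subgroup.normalizer (P : Set G) := by
  have hKS : P ⊔ A ≤ S := sup_le hP hA
  have : Finite (P ⊔ A : Subgroup G) := Finite.of_injective _ (Subgroup.inclusion_injective hKS)
  have hK : IsPGroup p (P ⊔ A : Subgroup G) :=
    hS.of_injective _ (Subgroup.inclusion_injective hKS)
  have := hK.isNilpotent
  have hlt : P.subgroupOf (P ⊔ A) < ⊤ := by
    rw [lt_top_iff_ne_top, Ne, Subgroup.subgroupOf_eq_top]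
    exact fun h => hAP (le_sup_right.trans h)
  obtain ⟨⟨g, hgK⟩, hgN, hgP⟩ := SetLike.exists_of_lt (Group.normalizerCondition_of_isNilpotent _ hlt)
  rw [Subgroup.mem_subgroupOf] at hgP
  have hgN' : g ∈ Subgroup.normalizer (P : Set G) := by
    rw [Subgroup.mem_normalizer_iff] at hgN ⊢
    intro x
    constructor
    · intro hx
      simpa [Subgroup.mem_subgroupOf] using
        (hgN ⟨x, Subgroup.mem_sup_left hx⟩).1 (Subgroup.mem_subgroupOf.2 hx)
    · intro hx
      have hxK : x ∈ P ⊔ A := by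
        have := (P ⊔ A).mul_mem ((P ⊔ A).mul_mem ((P ⊔ A).inv_mem hgK)
          (Subgroup.mem_sup_left (T := A) hx)) hgK
        simpa [mul_assoc] using this
      simpa [Subgroup.mem_subgroupOf] using (hgN ⟨x, hxK⟩).2 (by simpa [Subgroup.mem_subgroupOf])
  -- Dividing `g = y * a` by `y ∈ P` leaves an element of `A` that still normalizes `P`.
  obtain ⟨y, hy, a, ha, rfl⟩ : g ∈ (P : Set G) * (A : Set G) := by
    rwa [← Subgroup.coe_mul_of_left_le_normalizer_right P A hPA]
  refine ⟨a, ha, fun h => hgP (P.mul_mem hy h), ?_⟩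
  have := Subgroup.mul_mem _ (Subgroup.inv_mem _ (Subgroup.le_normalizer hy)) hgN'
  simpa using this

theorem relIndex_sup_right_of_le_normalizer {U A : Subgroup G}
    (h : U ≤ Subgroup.normalizer (A : Set G)) : A.relIndex (U ⊔ A) = A.relIndex U :=
  letI := Subgroup.normal_subgroupOf_of_le_normalizer h
  letI := Subgroup.normal_subgroupOf_sup_of_le_normalizer h
  (Nat.card_congr (QuotientGroup.quotientInfEquivProdNormalizerQuotient U A h).toEquiv).symm

/-! ### Morphisms as functions on the ambient group, so that restriction keeps the same function. -/

namespace FusionSystem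

variable {S : Subgroup G} (F : FusionSystem S)

/-- The function `f` restricts to an isomorphism `P → Q` of the fusion system. -/
def Realizes (f : G → G) (P Q : Subgroup G) : Prop :=
  ∃ φ ∈ F.Iso P Q, ∀ x : P, (φ x : G) = f x

variable {F} {P Q R P' Q' : Subgroup G} {f g : G → G}

theorem mem_conjClass_iff_exists_realizes : Q ∈ F.conjClass P ↔ ∃ f, F.Realizes f P Q := by
  classical
  constructor
  · rintro ⟨φ, hφ⟩
    exact ⟨fun x => if h : x ∈ P then φ ⟨x, h⟩ else 1, φ, hφ, fun x => by simp⟩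
  · rintro ⟨f, φ, hφ, -⟩
    exact ⟨φ, hφ⟩

theorem realizes_of_mem_hom {φ : P →* Q} (hφ : φ ∈ F.Hom P Q) (hf : ∀ x : P, (φ x : G) = f x) :
    ∃ R ≤ Q, F.Realizes f P R := by
  obtain ⟨R, hR, ψ, h1, h2, rfl⟩ := F.factor hφ
  exact ⟨R, hR, ψ, ⟨h1, h2⟩, hf⟩

theorem exists_realizes_of_mem_hom {φ : P →* Q} (hφ : φ ∈ F.Hom P Q) :
    ∃ (f : G → G) (R : Subgroup G), R ≤ Q ∧ F.Realizes f P R ∧ ∀ x : P, (φ x : G) = f x := by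
  classical
  let f : G → G := fun x => if h : x ∈ P then (φ ⟨x, h⟩ : G) else 1
  have hf : ∀ x : P, (φ x : G) = f x := by simp [f]
  obtain ⟨R, hR, h⟩ := realizes_of_mem_hom hφ hf
  exact ⟨f, R, hR, h, hf⟩

namespace Realizes

theorem le_left (h : F.Realizes f P Q) : P ≤ S := by
  obtain ⟨φ, hφ, -⟩ := h
  exact (F.le_of_mem hφ.1).1

theorem le_right (h : F.Realizes f P Q) : Q ≤ S := by
  obtain ⟨φ, hφ, -⟩ := h
  exact (F.le_of_mem hφ.1).2

theorem mem_conjClass (h : F.Realizes f P Q) : Q ∈ F.conjClass P :=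
  mem_conjClass_iff_exists_realizes.2 ⟨f, h⟩

theorem bijOn (h : F.Realizes f P Q) : Set.BijOn f P Q := by
  obtain ⟨φ, -, hφ⟩ := h
  refine ⟨fun x hx => ?_, fun x hx y hy hxy => ?_, fun y hy => ?_⟩
  · rw [← hφ ⟨x, hx⟩]
    exact (φ _).2
  · rw [← hφ ⟨x, hx⟩, ← hφ ⟨y, hy⟩] at hxy
    exact congrArg Subtype.val (φ.injective (Subtype.ext hxy))
  · refine ⟨φ.symm ⟨y, hy⟩, (φ.symm _).2, ?_⟩
    rw [← hφ, φ.apply_symm_apply]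

theorem map_mem (h : F.Realizes f P Q) {x : G} (hx : x ∈ P) : f x ∈ Q := h.bijOn.mapsTo hx

theorem map_mul (h : F.Realizes f P Q) {x y : G} (hx : x ∈ P) (hy : y ∈ P) :
    f (x * y) = f x * f y := by
  obtain ⟨φ, -, hφ⟩ := h
  rw [← hφ ⟨x, hx⟩, ← hφ ⟨y, hy⟩, ← hφ ⟨x * y, P.mul_mem hx hy⟩, ← Subgroup.coe_mul, ← _root_.map_mul]
  rfl

theorem map_inv (h : F.Realizes f P Q) {x : G} (hx : x ∈ P) : f x⁻¹ = (f x)⁻¹ := by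
  obtain ⟨φ, -, hφ⟩ := h
  rw [← hφ ⟨x, hx⟩, ← hφ ⟨x⁻¹, P.inv_mem hx⟩, ← Subgroup.coe_inv, ← _root_.map_inv]
  rfl

theorem map_conj (h : F.Realizes f P Q) {x y : G} (hx : x ∈ P) (hy : y ∈ P) :
    f (x * y * x⁻¹) = f x * f y * (f x)⁻¹ := by
  rw [h.map_mul (P.mul_mem hx hy) (P.inv_mem hx), h.map_mul hx hy, h.map_inv hx]

theorem card_eq (h : F.Realizes f P Q) : Nat.card P = Nat.card Q := by
  obtain ⟨φ, -, -⟩ := h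
  exact Nat.card_congr φ.toEquiv

theorem congr (h : F.Realizes f P Q) (hfg : ∀ x ∈ P, f x = g x) : F.Realizes g P Q := by
  obtain ⟨φ, hφ, hf⟩ := h
  exact ⟨φ, hφ, fun x => (hf x).trans (hfg x x.2)⟩

theorem comp (hg : F.Realizes g Q R) (hf : F.Realizes f P Q) : F.Realizes (g ∘ f) P R := by
  obtain ⟨φ, hφ, hf⟩ := hf
  obtain ⟨ψ, hψ, hg⟩ := hg
  exact ⟨φ.trans ψ, ⟨F.comp_mem hφ.1 hψ.1, F.comp_mem hψ.2 hφ.2⟩, fun x => by simp [hg, hf]⟩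

theorem symm (h : F.Realizes f P Q) :
    ∃ g, F.Realizes g Q P ∧ (∀ x ∈ P, g (f x) = x) ∧ ∀ y ∈ Q, f (g y) = y := by
  classical
  obtain ⟨φ, hφ, hf⟩ := h
  refine ⟨fun x => if h : x ∈ Q then φ.symm ⟨x, h⟩ else 1, ⟨φ.symm, ⟨hφ.2, hφ.1⟩, by simp⟩, ?_, ?_⟩
  · intro x hx
    simp [← hf ⟨x, hx⟩]
  · intro y hy
    simp [hy, ← hf]

theorem exists_mem_hom (h : F.Realizes f P R) (hRQ : R ≤ Q) (hQ : Q ≤ S) :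
    ∃ φ ∈ F.Hom P Q, ∀ x : P, (φ x : G) = f x := by
  obtain ⟨φ, hφ, hf⟩ := h
  exact ⟨(Subgroup.inclusion hRQ).comp φ.toMonoidHom, F.comp_mem hφ.1
    (F.conjHoms_subset (hRQ.trans hQ) hQ ⟨1, S.one_mem, by simp⟩), hf⟩

theorem restrict (h : F.Realizes f P Q) (hP : P' ≤ P) : ∃ Q' ≤ Q, F.Realizes f P' Q' := by
  obtain ⟨φ, hφ, hf⟩ := h
  exact realizes_of_mem_hom (φ := φ.toMonoidHom.comp (Subgroup.inclusion hP))
    (F.comp_mem (F.conjHoms_subset (hP.trans (F.le_of_mem hφ.1).1) (F.le_of_mem hφ.1).1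
      ⟨1, S.one_mem, by simp⟩) hφ.1) fun x => hf _

theorem image_eq (h : F.Realizes f P Q) : f '' P = Q := h.bijOn.image_eq

theorem restrict_of_image_eq (h : F.Realizes f P Q) (hP : P' ≤ P) (hQ : f '' P' = Q') :
    F.Realizes f P' Q' := by
  obtain ⟨R, -, hR⟩ := h.restrict hP
  rwa [← SetLike.coe_injective (hR.image_eq.symm.trans hQ)]

theorem right_unique (h : F.Realizes f P Q) (h' : F.Realizes f P Q') : Q = Q' :=
  SetLike.coe_injective (h.image_eq.symm.trans h'.image_eq)

theorem commute (h : F.Realizes f P Q) [IsMulCommutative Q] {x y : G} (hx : x ∈ P) (hy : y ∈ P) :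
    x * y = y * x := by
  refine h.bijOn.injOn (P.mul_mem hx hy) (P.mul_mem hy hx) ?_
  rw [h.map_mul hx hy, h.map_mul hy hx]
  exact setLike_mul_comm (h.map_mem hx) (h.map_mem hy)

end Realizes

theorem realizes_id (hP : P ≤ S) : F.Realizes id P P :=
  ⟨MulEquiv.refl P, ⟨F.conjHoms_subset hP hP ⟨1, S.one_mem, by simp⟩,
    F.conjHoms_subset hP hP ⟨1, S.one_mem, by simp⟩⟩, fun _ => rfl⟩

theorem realizes_conj (hP : P ≤ S) {s : G} (hs : s ∈ S) :
    F.Realizes (fun x => s * x * s⁻¹) P (P.map (MulAut.conj s).toMonoidHom) := by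
  have hQ : P.map (MulAut.conj s).toMonoidHom ≤ S := by
    rintro _ ⟨x, hx, rfl⟩
    exact S.mul_mem (S.mul_mem hs (hP hx)) (S.inv_mem hs)
  refine ⟨P.equivMapOfInjective _ (MulAut.conj s).injective,
    ⟨F.conjHoms_subset hP hQ ⟨s, hs, fun x => rfl⟩,
    F.conjHoms_subset hQ hP ⟨s⁻¹, S.inv_mem hs, fun x => ?_⟩⟩, fun x => rfl⟩
  obtain ⟨x, rfl⟩ := (P.equivMapOfInjective _ (MulAut.conj s).injective).surjective x
  refine (congrArg Subtype.val (MulEquiv.symm_apply_apply _ x)).trans ?_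
  change (x : G) = s⁻¹ * (s * x * s⁻¹) * s⁻¹⁻¹
  group

theorem conjClass_trans (h : Q ∈ F.conjClass P) (h' : R ∈ F.conjClass Q) : R ∈ F.conjClass P := by
  obtain ⟨φ, hφ⟩ := h
  obtain ⟨ψ, hψ⟩ := h'
  exact ⟨φ.trans ψ, F.comp_mem hφ.1 hψ.1, F.comp_mem hψ.2 hφ.2⟩

theorem conjClass_symm (h : Q ∈ F.conjClass P) : P ∈ F.conjClass Q := by
  obtain ⟨φ, hφ⟩ := h
  exact ⟨φ.symm, hφ.2, hφ.1⟩

theorem le_of_mem_conjClass (h : Q ∈ F.conjClass P) : Q ≤ S := by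
  obtain ⟨φ, hφ⟩ := h
  exact (F.le_of_mem hφ.1).2

theorem exists_isFullyNormalized [Finite S] (hP : P ≤ S) :
    ∃ Q ∈ F.conjClass P, F.IsFullyNormalized Q := by
  let s : Set ℕ := (fun Q => Nat.card (normalizerIn S Q)) '' F.conjClass P
  have hne : s.Nonempty := ⟨_, P, (realizes_id hP).mem_conjClass, rfl⟩
  have hbdd : BddAbove s := by
    refine ⟨Nat.card S, ?_⟩
    rintro _ ⟨Q, -, rfl⟩
    exact Subgroup.card_le_of_le inf_le_left
  obtain ⟨Q, hQ, hmax⟩ := Nat.sSup_mem hne hbdd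
  refine ⟨Q, hQ, le_of_mem_conjClass hQ, fun R hR => ?_⟩
  have : Nat.card (normalizerIn S R) ≤ sSup s := le_csSup hbdd ⟨R, conjClass_trans hQ hR, rfl⟩
  exact this.trans hmax.ge

end FusionSystem

end

/-! ### Consequences of the saturation axioms. -/

section

variable {G : Type*} [Group G]

namespace FusionSystem

variable {S : Subgroup G} {F : FusionSystem S} {P Q R : Subgroup G} {f : G → G} {p : ℕ}

/-- The element `m` need not be assumed to normalize `Q`: this follows from the intertwining
relation, as `s` normalizes `P` and `f` maps `P` onto `Q`. -/
theorem mem_extensionSubgroup {φ : P ≃* Q} (hf : ∀ x : P, (φ x : G) = f x)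
    {s m : G} (hs : s ∈ S) (hsP : s ∈ Subgroup.normalizer (P : Set G)) (hm : m ∈ S)
    (h : ∀ x ∈ P, f (s * x * s⁻¹) = m * f x * m⁻¹) : s ∈ extensionSubgroup S φ := by
  have hfs (y : Q) : (y : G) = f (φ.symm y) := by rw [← hf, φ.apply_symm_apply]
  have hsx (x : P) : s * x * s⁻¹ ∈ P := (Subgroup.mem_normalizer_iff.1 hsP x).1 x.2
  have hmQ : m ∈ Subgroup.normalizer (Q : Set G) := by
    refine Subgroup.mem_normalizer_iff.2 fun y => ⟨fun hy => ?_, fun hy => ?_⟩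
    · have h1 := h _ (φ.symm ⟨y, hy⟩).2
      rw [← hfs, ← hf ⟨_, hsx _⟩] at h1
      rw [← show _ = m * y * m⁻¹ from h1]
      exact (φ _).2
    · have h2 := (Subgroup.mem_normalizer_iff''.1 hsP (φ.symm ⟨_, hy⟩)).1 (φ.symm _).2
      have h3 := h _ h2
      have h4 := hfs ⟨_, hy⟩
      have h5 : s * (s⁻¹ * (φ.symm ⟨_, hy⟩ : G) * s) * s⁻¹ = φ.symm ⟨_, hy⟩ := by group
      rw [h5, ← h4] at h3
      have h6 : y = f (s⁻¹ * (φ.symm ⟨_, hy⟩ : G) * s) := mul_left_cancel (mul_right_cancel h3)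
      rw [h6, ← hf ⟨_, h2⟩]
      exact (φ _).2
  refine ⟨hs, ⟨s, hsP⟩, ⟨⟨m, hmQ⟩, hm, ?_⟩, rfl⟩
  ext y
  change m * y * m⁻¹ = ((φ ⟨s * (φ.symm y) * s⁻¹, hsx _⟩ : Q) : G)
  rw [hf, h _ (φ.symm y).2, ← hfs]

/-- The extension axiom, for functions on the ambient group. -/
theorem IsSaturated.exists_extension (hF : F.IsSaturated p) (hPQ : F.Realizes f P Q)
    (hQ : F.IsFullyCentralized Q) :
    ∃ (g : G → G) (K K' : Subgroup G), F.Realizes g K K' ∧ P ≤ K ∧ (∀ x ∈ P, g x = f x) ∧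
      ∀ s ∈ normalizerIn S P, (∃ m ∈ S, ∀ x ∈ P, f (s * x * s⁻¹) = m * f x * m⁻¹) → s ∈ K := by
  obtain ⟨φ, hφ, hf⟩ := hPQ
  obtain ⟨ψ, hψ, hle, hψφ⟩ := hF.extension_axiom P Q φ hφ hQ
  obtain ⟨g, T, -, hg, hgψ⟩ := exists_realizes_of_mem_hom hψ
  refine ⟨g, _, T, hg, hle, fun x hx => ?_, fun s hs ⟨m, hm, h⟩ =>
    mem_extensionSubgroup hf hs.1 hs.2 hm h⟩
  rw [← hf ⟨x, hx⟩, ← hgψ ⟨x, hle hx⟩]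
  exact hψφ ⟨x, hx⟩

theorem IsSaturated.exists_extension_of_le (hF : F.IsSaturated p) (hPQ : F.Realizes f P Q)
    (hQ : F.IsFullyCentralized Q) {K : Subgroup G} (hK : K ≤ normalizerIn S P)
    (h : ∀ s ∈ K, ∃ m ∈ S, ∀ x ∈ P, f (s * x * s⁻¹) = m * f x * m⁻¹) :
    ∃ (g : G → G) (K' : Subgroup G), F.Realizes g K K' ∧ ∀ x ∈ P, g x = f x := by
  obtain ⟨g, L, L', hg, -, hgf, hL⟩ := hF.exists_extension hPQ hQ
  obtain ⟨K', -, hK'⟩ := hg.restrict fun s hs => hL s (hK hs) (h s hs)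
  exact ⟨g, K', hK', hgf⟩

theorem IsSaturated.exists_extension_centralizerIn (hF : F.IsSaturated p)
    (hPQ : F.Realizes f P Q) (hQ : F.IsFullyCentralized Q) :
    ∃ (g : G → G) (K' : Subgroup G), F.Realizes g (centralizerIn S P) K' ∧ ∀ x ∈ P, g x = f x := by
  refine hF.exists_extension_of_le hPQ hQ
    (inf_le_inf_left _ (Subgroup.centralizer_le_normalizer _)) fun s hs => ⟨1, S.one_mem, fun x hx => ?_⟩
  rw [← Subgroup.mem_centralizer_iff.1 hs.2 x hx]
  simp

theorem normalizerMonoidHom_mem_aut (hP : P ≤ S) {s : G} (hs : s ∈ S)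
    (hsP : s ∈ Subgroup.normalizer (P : Set G)) :
    P.normalizerMonoidHom ⟨s, hsP⟩ ∈ F.Aut P hP := by
  refine ⟨F.conjHoms_subset hP hP ⟨s, hs, fun x => rfl⟩,
    F.conjHoms_subset hP hP ⟨s⁻¹, S.inv_mem hs, fun x => ?_⟩⟩
  rw [← MulAut.inv_def, ← _root_.map_inv]
  rfl

/-- Sylow's theorem in `Aut_F(Q)`, where `Aut_S(Q)` is a Sylow subgroup. -/
theorem IsSaturated.exists_conj_le_conjAuts [Fact p.Prime] [Finite S] (hF : F.IsSaturated p)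
    (hQ : F.IsFullyNormalized Q) {E : Subgroup (MulAut Q)} (hE : E ≤ F.Aut Q hQ.1)
    (hEp : IsPGroup p E) :
    ∃ χ ∈ F.Aut Q hQ.1, ∀ e ∈ E, χ * e * χ⁻¹ ∈ conjAuts S Q := by
  have : Finite Q := Finite.of_injective _ (Subgroup.inclusion_injective hQ.1)
  have : Finite (MulAut Q) := DFunLike.finite _
  obtain ⟨-, -, T, hT⟩ := hF.sylow_axiom Q hQ.1 hQ
  have hE' : IsPGroup p (E.subgroupOf (F.Aut Q hQ.1)) := hEp.comap_subtype
  obtain ⟨T', hT'⟩ := hE'.exists_le_sylow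
  obtain ⟨χ, hχ⟩ := MulAction.exists_smul_eq (F.Aut Q hQ.1) T' T
  refine ⟨χ, χ.2, fun e he => ?_⟩
  have h1 : χ * ⟨e, hE he⟩ * χ⁻¹ ∈ (χ • T' : Sylow p _) :=
    Sylow.smul_def (g := χ) (P := T') ▸ Subgroup.smul_mem_pointwise_smul _ (MulAut.conj χ) _
      (hT' (Subgroup.mem_subgroupOf.2 he))
  rw [hχ] at h1
  change χ * ⟨e, hE he⟩ * χ⁻¹ ∈ (T : Subgroup (F.Aut Q hQ.1)) at h1
  rw [hT] at h1
  exact h1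

/-- If `P` is conjugate to the fully normalized subgroup `Q`, then some isomorphism `P → Q` extends
to `N_S(P)`. -/
theorem IsSaturated.exists_realizes_normalizerIn [Fact p.Prime] [Finite S] (hS : IsPGroup p S)
    (hF : F.IsSaturated p) (hQ : F.IsFullyNormalized Q) (hPQ : Q ∈ F.conjClass P) :
    ∃ (g : G → G) (N' : Subgroup G), F.Realizes g (normalizerIn S P) N' ∧ F.Realizes g P Q := by
  obtain ⟨φ, hφ⟩ := hPQ
  have hP : P ≤ S := (F.le_of_mem hφ.1).1
  -- `E` is `Aut_S(P)` transported to `Q`. Once `χ` conjugates it into `Aut_S(Q)`, the extension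
  -- subgroup of `χ ∘ φ` contains all of `N_S(P)`.
  let E : Subgroup (MulAut Q) := (conjAuts S P).map (MulAut.congr φ).toMonoidHom
  have hE : E ≤ F.Aut Q hQ.1 := by
    rintro _ ⟨_, ⟨⟨s, hsP⟩, hs, rfl⟩, rfl⟩
    have := normalizerMonoidHom_mem_aut (F := F) hP hs hsP
    exact ⟨F.comp_mem hφ.2 (F.comp_mem this.1 hφ.1), F.comp_mem hφ.2 (F.comp_mem this.2 hφ.1)⟩
  have hEp : IsPGroup p E := by
    refine IsPGroup.map (IsPGroup.map ?_ _) _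
    exact hS.comap_subtype
  obtain ⟨χ, hχ, hχE⟩ := hF.exists_conj_le_conjAuts hQ hE hEp
  let ψ : P ≃* Q := φ.trans χ
  have hψ : ψ ∈ F.Iso P Q := ⟨F.comp_mem hφ.1 hχ.1, F.comp_mem hχ.2 hφ.2⟩
  obtain ⟨f, R, -, hfR, hf⟩ := exists_realizes_of_mem_hom hψ.1
  have hψf : F.Realizes f P Q := ⟨ψ, hψ, hf⟩
  obtain ⟨g, N', hg, hgf⟩ := hF.exists_extension_of_le hψf (hF.sylow_axiom Q hQ.1 hQ).1 le_rfl (by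
      rintro s ⟨hs, hsP⟩
      obtain ⟨⟨m, hmQ⟩, hm, h⟩ := hχE _ ⟨_, ⟨⟨s, hsP⟩, hs, rfl⟩, rfl⟩
      refine ⟨m, hm, fun x hx => ?_⟩
      have hsx : s * x * s⁻¹ ∈ P := (Subgroup.mem_normalizer_iff.1 hsP x).1 hx
      have h1 := congrArg Subtype.val (DFunLike.congr_fun h (ψ ⟨x, hx⟩))
      have h2 : (χ * (MulAut.congr φ) (P.normalizerMonoidHom ⟨s, hsP⟩) * χ⁻¹) (ψ ⟨x, hx⟩) =
          ψ ⟨s * x * s⁻¹, hsx⟩ := by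
        change χ (φ (P.normalizerMonoidHom ⟨s, hsP⟩ (φ.symm (χ.symm (χ (φ ⟨x, hx⟩)))))) = _
        rw [MulEquiv.symm_apply_apply, MulEquiv.symm_apply_apply]
        rfl
      rw [← hf ⟨x, hx⟩, ← hf ⟨_, hsx⟩]
      exact (congrArg Subtype.val h2).symm.trans h1.symm)
  exact ⟨g, N', hg, hψf.congr fun x hx => (hgf x hx).symm⟩

theorem IsSaturated.exists_isFullyCentralized [Finite S] (hF : F.IsSaturated p) (hP : P ≤ S) :
    ∃ Q ∈ F.conjClass P, F.IsFullyCentralized Q := by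
  obtain ⟨Q, hQ, h⟩ := F.exists_isFullyNormalized hP
  exact ⟨Q, hQ, (hF.sylow_axiom Q h.1 h).1⟩

end FusionSystem

end

/-! ### Abelian strongly closed subgroups are normal. -/

section

variable {G : Type*} [Group G]

namespace FusionSystem

variable {S : Subgroup G} {F : FusionSystem S} {A P Q R K L P' Q' : Subgroup G} {f g : G → G} {p : ℕ}

theorem Realizes.exists_preimage (h : F.Realizes f P Q) (hQ : Q' ≤ Q) :
    ∃ P' ≤ P, F.Realizes f P' Q' ∧ ∀ x ∈ P, f x ∈ Q' → x ∈ P' := by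
  obtain ⟨g, hg, hgf, hfg⟩ := h.symm
  obtain ⟨P', hP', h'⟩ := hg.restrict hQ
  refine ⟨P', hP', h.restrict_of_image_eq hP' ?_, fun x hx hfx => ?_⟩
  · ext y
    constructor
    · rintro ⟨x, hx, rfl⟩
      obtain ⟨y, hy, rfl⟩ := h'.bijOn.surjOn hx
      rwa [hfg y (hQ hy)]
    · exact fun hy => ⟨g y, h'.map_mem hy, hfg y (hQ hy)⟩
  · rw [← hgf x hx]
    exact h'.map_mem hfx

theorem Realizes.right_eq_sup (h : F.Realizes f (P ⊔ P') R) (hP : F.Realizes f P Q)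
    (hP' : F.Realizes f P' Q') : R = Q ⊔ Q' := by
  have hQ : Q ⊔ Q' ≤ R := by
    refine sup_le (fun y hy => ?_) fun y hy => ?_
    · obtain ⟨x, hx, rfl⟩ := hP.bijOn.surjOn hy
      exact h.map_mem (Subgroup.mem_sup_left hx)
    · obtain ⟨x, hx, rfl⟩ := hP'.bijOn.surjOn hy
      exact h.map_mem (Subgroup.mem_sup_right hx)
  obtain ⟨T, hT, hTQ, hTmem⟩ := h.exists_preimage hQ
  have : P ⊔ P' = T := le_antisymm (sup_le
    (fun x hx => hTmem x (Subgroup.mem_sup_left hx) (Subgroup.mem_sup_left (hP.map_mem hx)))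
    (fun x hx => hTmem x (Subgroup.mem_sup_right hx) (Subgroup.mem_sup_right (hP'.map_mem hx)))) hT
  subst this
  exact h.right_unique hTQ

/-- The automorphisms of `P` in the fusion system that act trivially on `P ∩ A` and on `P / (P ∩ A)`. -/
def unipotentAuts (F : FusionSystem S) (A P : Subgroup G) (hP : P ≤ S) : Subgroup (MulAut P) where
  carrier := {α | α ∈ F.Aut P hP ∧ (∀ x : P, (x : G) ∈ A → α x = x) ∧
    ∀ x : P, ((x⁻¹ * α x : P) : G) ∈ A}
  one_mem' := ⟨one_mem _, fun x _ => rfl, fun x => by simp⟩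
  mul_mem' := by
    rintro α β ⟨hα, hα1, hα2⟩ ⟨hβ, hβ1, hβ2⟩
    refine ⟨mul_mem hα hβ, fun x hx => ?_, fun x => ?_⟩
    · rw [MulAut.mul_apply, hβ1 x hx, hα1 x hx]
    · have := A.mul_mem (hβ2 x) (hα2 (β x))
      rw [← Subgroup.coe_mul] at this
      simpa [mul_assoc] using this
  inv_mem' := by
    rintro α ⟨hα, hα1, hα2⟩
    refine ⟨inv_mem hα, fun x hx => ?_, fun x => ?_⟩
    · conv_lhs => rw [← hα1 x hx]
      exact MulAut.inv_apply_self _ _ _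
    · have := A.inv_mem (hα2 (α⁻¹ x))
      rw [MulAut.apply_inv_self, ← Subgroup.coe_inv] at this
      simpa using this

/-- The element `d = x⁻¹ * α x` lies in `A`, so `α` fixes it and `α ^ n` sends `x` to `x * d ^ n`.
Hence `α ^ |S| = 1`. -/
theorem isPGroup_unipotentAuts [Fact p.Prime] [Finite S] (hS : IsPGroup p S) (hP : P ≤ S) :
    IsPGroup p (F.unipotentAuts A P hP) := by
  rintro ⟨α, hα, h1, h2⟩
  obtain ⟨k, hk⟩ := IsPGroup.iff_card.1 hS
  refine ⟨k, Subtype.ext (MulEquiv.ext fun x => ?_)⟩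
  have key : ∀ n : ℕ, (α ^ n) x = x * (x⁻¹ * α x) ^ n := by
    intro n
    induction n with
    | zero => simp
    | succ n ih =>
      rw [pow_succ', MulAut.mul_apply, ih, map_mul, map_pow, h1 _ (h2 x), pow_succ' _ n, ← mul_assoc x,
        mul_inv_cancel_left]
  have hone : (x⁻¹ * α x : P) ^ p ^ k = 1 := by
    apply Subgroup.inclusion_injective hP
    rw [map_pow, ← hk, map_one]
    exact pow_card_eq_one'
  change (α ^ p ^ k) x = x
  rw [key, hone, mul_one]

/-- `A` is strongly closed: morphisms map elements of `A` into `A`. -/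
def IsStronglyClosed (F : FusionSystem S) (A : Subgroup G) : Prop :=
  ∀ ⦃P Q : Subgroup G⦄, ∀ φ ∈ F.Hom P Q, ∀ x : P, (x : G) ∈ A → (φ x : G) ∈ A

namespace IsStronglyClosed

theorem map_mem (hA : F.IsStronglyClosed A) (h : F.Realizes f P Q) {x : G} (hx : x ∈ P)
    (hxA : x ∈ A) : f x ∈ A := by
  obtain ⟨φ, hφ, hf⟩ := h
  rw [← hf ⟨x, hx⟩]
  exact hA _ hφ.1 ⟨x, hx⟩ hxA

theorem realizes [Finite S] (hA : F.IsStronglyClosed A) (h : F.Realizes f P Q) (hP : A ≤ P) :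
    F.Realizes f A A := by
  obtain ⟨B, -, hB⟩ := h.restrict hP
  have : Finite A := Finite.of_injective _ (Subgroup.inclusion_injective hB.le_left)
  have hle : B ≤ A := fun y hy => by
    obtain ⟨x, hx, rfl⟩ := hB.bijOn.surjOn hy
    exact hA.map_mem hB hx hx
  rwa [Subgroup.eq_of_le_of_card_ge hle hB.card_eq.le] at hB

theorem le_normalizer (hA : F.IsStronglyClosed A) (hAS : A ≤ S) :
    S ≤ Subgroup.normalizer (A : Set G) := by
  intro s hs
  refine Subgroup.mem_normalizer_iff.2 fun x => ⟨fun hx => ?_, fun hx => ?_⟩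
  · exact hA.map_mem (realizes_conj hAS hs) hx hx
  · simpa [mul_assoc] using hA.map_mem (realizes_conj hAS (S.inv_mem hs)) hx hx

variable [Fact p.Prime] [Finite S] [IsMulCommutative A]

/-- Conjugation by `a` is trivial on `R ∩ A`, since `A` is abelian, and on `R / (R ∩ A)`, since `R`
normalizes `A`. Strong closure gives the same for all its conjugates under `Aut_F(R)`. These
therefore lie in one `p`-subgroup, which Sylow's theorem moves into `Aut_S(R)`. -/
theorem exists_extension_of_isFullyNormalized (hS : IsPGroup p S) (hF : F.IsSaturated p)
    (hA : F.IsStronglyClosed A) (hAS : A ≤ S) (hR : F.IsFullyNormalized R) (hf : F.Realizes f R R)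
    {a : G} (ha : a ∈ A) (haR : a ∈ Subgroup.normalizer (R : Set G)) :
    ∃ (g : G → G) (K K' : Subgroup G), F.Realizes g K K' ∧ R ≤ K ∧ a ∈ K ∧ ∀ x ∈ R, g x = f x := by
  obtain ⟨θ, hθ, hθE⟩ := hF.exists_conj_le_conjAuts hR (E := F.unipotentAuts A R hR.1)
    (fun e he => he.1) (isPGroup_unipotentAuts hS hR.1)
  obtain ⟨χ, hχ, hχf⟩ := id hf
  let c : MulAut R := R.normalizerMonoidHom ⟨a, haR⟩
  have hc : c ∈ F.Aut R hR.1 := normalizerMonoidHom_mem_aut hR.1 (hAS ha) haR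
  have hE : ∀ η ∈ F.Aut R hR.1, η * c * η⁻¹ ∈ F.unipotentAuts A R hR.1 := by
    intro η hη
    refine ⟨mul_mem (mul_mem hη hc) (inv_mem hη), fun x hx => ?_, fun x => ?_⟩
    · have hx' : ((η⁻¹ x : R) : G) ∈ A := hA _ hη.2 x hx
      have : c (η⁻¹ x) = η⁻¹ x := by
        apply Subtype.ext
        change a * (η⁻¹ x : R) * a⁻¹ = (η⁻¹ x : R)
        rw [setLike_mul_comm ha hx', mul_inv_cancel_right]
      rw [MulAut.mul_apply, MulAut.mul_apply, this, MulAut.apply_inv_self]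
    · obtain ⟨y, rfl⟩ := η.surjective x
      have h1 : ((y⁻¹ * c y : R) : G) ∈ A := by
        change (y : G)⁻¹ * (a * y * a⁻¹) ∈ A
        have := (Subgroup.mem_normalizer_iff''.1 (hA.le_normalizer hAS (hR.1 y.2)) a).1 ha
        simpa [mul_assoc] using A.mul_mem this (A.inv_mem ha)
      have h2 : ((η (y⁻¹ * c y) : R) : G) ∈ A := hA _ hη.1 _ h1
      rw [map_mul, _root_.map_inv] at h2
      rw [MulAut.mul_apply, MulAut.mul_apply, MulAut.inv_apply_self]
      exact h2
  -- The factor `θ⁻¹` cancels the Sylow conjugation, so that `χ * c * χ⁻¹` itself lies in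
  -- `Aut_S(R)`, which is the condition for `f` to extend to `a`.
  have hm := hθE _ (hE (θ⁻¹ * χ) (mul_mem (inv_mem hθ) hχ))
  obtain ⟨⟨m, hmR⟩, hm, h⟩ := hm
  obtain ⟨g, K, K', hg, hRK, hgf, hK⟩ := hF.exists_extension hf (hF.sylow_axiom R hR.1 hR).1
  refine ⟨g, K, K', hg, hRK, hK a ⟨hAS ha, haR⟩ ⟨m, hm, fun x hx => ?_⟩, hgf⟩
  have hax : a * x * a⁻¹ ∈ R := (Subgroup.mem_normalizer_iff.1 haR x).1 hx
  have h1 := congrArg Subtype.val (DFunLike.congr_fun h (χ ⟨x, hx⟩))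
  have h2 : (θ * (θ⁻¹ * χ * c * (θ⁻¹ * χ)⁻¹) * θ⁻¹) (χ ⟨x, hx⟩) = χ ⟨a * x * a⁻¹, hax⟩ := by
    rw [show θ * (θ⁻¹ * χ * c * (θ⁻¹ * χ)⁻¹) * θ⁻¹ = χ * c * χ⁻¹ by group, MulAut.mul_apply,
      MulAut.mul_apply, MulAut.inv_apply_self]
    rfl
  rw [← hχf ⟨x, hx⟩, ← hχf ⟨_, hax⟩]
  exact (congrArg Subtype.val h2).symm.trans h1.symm

/-- It is enough to extend to any strictly larger subgroup, because induction does the rest. To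
achieve this, `f` is factored through a fully normalized conjugate `R` as `P → R → R → Q`. The outer
maps come from morphisms on normalizers, and the middle one extends to an element of `A` outside
`R`. -/
theorem exists_extension_sup (hS : IsPGroup p S) (hF : F.IsSaturated p)
    (hA : F.IsStronglyClosed A) (hAS : A ≤ S) (hf : F.Realizes f P Q) :
    ∃ g, F.Realizes g (P ⊔ A) (Q ⊔ A) ∧ ∀ x ∈ P, g x = f x := by
  induction hn : Nat.card S - Nat.card P using Nat.strong_induction_on generalizing P Q f with
  | _ n ih =>
  have hnorm := hA.le_normalizer hAS
  have trivial_case {P' Q' : Subgroup G} {f' : G → G} (h : F.Realizes f' P' Q') (hAP : A ≤ P') :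
      ∃ g, F.Realizes g (P' ⊔ A) (Q' ⊔ A) ∧ ∀ x ∈ P', g x = f' x := by
    have hAQ : A ≤ Q' := fun y hy => by
      obtain ⟨x, hx, rfl⟩ := (hA.realizes h hAP).bijOn.surjOn hy
      exact h.map_mem (hAP hx)
    rw [sup_of_le_left hAP, sup_of_le_left hAQ]
    exact ⟨f', h, fun _ _ => rfl⟩
  have step {P' Q' K K' : Subgroup G} {f' g' : G → G} (hP' : Nat.card P' = Nat.card P)
      (h : F.Realizes f' P' Q') (h' : F.Realizes g' K K') (hlt : P' < K)
      (hfg : ∀ x ∈ P', g' x = f' x) :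
      ∃ g, F.Realizes g (P' ⊔ A) (Q' ⊔ A) ∧ ∀ x ∈ P', g x = f' x := by
    have hcard : Nat.card P' < Nat.card K := by
      have : Finite K := Finite.of_injective _ (Subgroup.inclusion_injective h'.le_left)
      exact lt_of_not_ge fun h => hlt.ne (Subgroup.eq_of_le_of_card_ge hlt.le h)
    have hcard' : Nat.card K ≤ Nat.card S := Subgroup.card_le_of_le h'.le_left
    obtain ⟨g, hg, hgg'⟩ := ih _ (by omega) h' rfl
    -- Induction gives a map on `K ⊔ A`. Its restriction to `P' ⊔ A` has image `Q' ⊔ A`, because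
    -- strong closure makes it map `A` onto `A`.
    obtain ⟨T, -, hT⟩ := hg.restrict (sup_le_sup_right hlt.le A)
    have hgf : ∀ x ∈ P', g x = f' x := fun x hx => (hgg' x (hlt.le hx)).trans (hfg x hx)
    have := hT.right_eq_sup (h.congr fun x hx => (hgf x hx).symm) (hA.realizes hT le_sup_right)
    subst this
    exact ⟨g, hT, hgf⟩
  obtain ⟨R, hRP, hR⟩ := F.exists_isFullyNormalized hf.le_left
  have to_normalized {P' : Subgroup G} (hP' : Nat.card P' = Nat.card P) (hP'S : P' ≤ S)
      (hRP' : R ∈ F.conjClass P') : ∃ ψ, F.Realizes ψ P' R ∧ F.Realizes ψ (P' ⊔ A) (R ⊔ A) := by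
    obtain ⟨ψ, N, hN, hψ⟩ := hF.exists_realizes_normalizerIn hS hR hRP'
    have : ∃ g, F.Realizes g (P' ⊔ A) (R ⊔ A) ∧ ∀ x ∈ P', g x = ψ x := by
      by_cases hAP : A ≤ P'
      · exact trivial_case hψ hAP
      · obtain ⟨a, ha, haP, haN⟩ :=
          exists_mem_normalizer_notMem hS hP'S hAS (hP'S.trans hnorm) hAP
        exact step hP' hψ hN ((le_inf hP'S Subgroup.le_normalizer).lt_of_not_ge
          fun h => haP (h ⟨hAS ha, haN⟩)) fun _ _ => rfl
    obtain ⟨g, hg, hgψ⟩ := this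
    exact ⟨g, hψ.congr fun x hx => (hgψ x hx).symm, hg⟩
  obtain ⟨ψ₁, h₁, h₁'⟩ := to_normalized rfl hf.le_left hRP
  obtain ⟨ψ₂, h₂, h₂'⟩ := to_normalized hf.card_eq.symm hf.le_right
    (conjClass_trans (conjClass_symm hf.mem_conjClass) hRP)
  obtain ⟨θ₁, hθ₁, hθψ₁, hψθ₁⟩ := h₁.symm
  obtain ⟨θ₂, hθ₂, hθψ₂, hψθ₂⟩ := h₂'.symm
  have hχ : F.Realizes (ψ₂ ∘ f ∘ θ₁) R R := h₂.comp (hf.comp hθ₁)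
  have : ∃ χ, F.Realizes χ (R ⊔ A) (R ⊔ A) ∧ ∀ x ∈ R, χ x = (ψ₂ ∘ f ∘ θ₁) x := by
    by_cases hAR : A ≤ R
    · exact trivial_case hχ hAR
    · obtain ⟨a, ha, haR, haN⟩ := exists_mem_normalizer_notMem hS hR.1 hAS (hR.1.trans hnorm) hAR
      obtain ⟨g, K, K', hg, hRK, haK, hgf⟩ :=
        hA.exists_extension_of_isFullyNormalized hS hF hAS hR hχ ha haN
      exact step h₁.card_eq.symm hχ hg (hRK.lt_of_not_ge fun h => haR (h haK)) hgf
  obtain ⟨χ, hχ', hχf⟩ := this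
  refine ⟨θ₂ ∘ χ ∘ ψ₁, hθ₂.comp (hχ'.comp h₁'), fun x hx => ?_⟩
  rw [Function.comp_apply, Function.comp_apply, hχf _ (h₁.map_mem hx), Function.comp_apply,
    Function.comp_apply, hθψ₁ x hx, hθψ₂ _ (Subgroup.mem_sup_left (hf.map_mem hx))]

/-- In a saturated fusion system, an abelian strongly closed subgroup is normal. -/
theorem isNormal (hS : IsPGroup p S) (hF : F.IsSaturated p)
    (hA : F.IsStronglyClosed A) (hAS : A ≤ S) : F.IsNormal A := by
  intro Q R φ hφ
  obtain ⟨f, T, -, hf, hφf⟩ := exists_realizes_of_mem_hom hφ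
  obtain ⟨g, hg, hgf⟩ := hA.exists_extension_sup hS hF hAS hf
  obtain ⟨ψ, hψ, hψg⟩ := hg.exists_mem_hom le_rfl hg.le_right
  refine ⟨_, _, ψ, hψ, ⟨le_sup_left, fun x => ?_⟩, le_sup_right, ?_⟩
  · rw [hψg, hφf]
    exact hgf x x.2
  · ext y
    have := hA.realizes hg le_sup_right
    constructor
    · rintro ⟨_, ⟨x, hx, rfl⟩, rfl⟩
      change (ψ x : G) ∈ A
      rw [hψg]
      exact this.map_mem hx
    · intro hy
      obtain ⟨x, hx, rfl⟩ := this.bijOn.surjOn hy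
      exact ⟨_, ⟨⟨x, Subgroup.mem_sup_right hx⟩, hx, rfl⟩, hψg _⟩

end IsStronglyClosed

end FusionSystem

end

/-! ### Counting fixed cosets. -/

section

variable {G : Type*} [Group G]

theorem le_normalizer_of_conj_mem {P Q : Subgroup G} (h : ∀ x ∈ P, ∀ y ∈ Q, x * y * x⁻¹ ∈ Q) :
    P ≤ Subgroup.normalizer (Q : Set G) := fun x hx =>
  Subgroup.mem_normalizer_iff.2 fun y => ⟨h x hx y, fun hy => by
    simpa [mul_assoc] using h x⁻¹ (P.inv_mem hx) _ hy⟩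

theorem relIndex_eq_of_card_eq {K L K' L' : Subgroup G} [Finite K] (h : K ≤ L) (h' : K' ≤ L')
    (hK : Nat.card K = Nat.card K') (hL : Nat.card L = Nat.card L') :
    K.relIndex L = K'.relIndex L' := by
  have h1 := Subgroup.relIndex_mul_relIndex ⊥ K L bot_le h
  have h2 := Subgroup.relIndex_mul_relIndex ⊥ K' L' bot_le h'
  rw [Subgroup.relIndex_bot_left, Subgroup.relIndex_bot_left] at h1 h2
  rw [← hK, ← hL] at h2
  exact Nat.eq_of_mul_eq_mul_left Nat.card_pos (h1.trans h2.symm)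

/-- The preimage in `A` of the group of cosets in `A / B` fixed by `t`. -/
def fixedSubgroup (A B : Subgroup G) [IsMulCommutative A] (hBA : B ≤ A) (t : G) : Subgroup G where
  carrier := {a | a ∈ A ∧ a⁻¹ * (t * a * t⁻¹) ∈ B}
  one_mem' := ⟨A.one_mem, by simp⟩
  mul_mem' := by
    rintro a b ⟨ha, ha'⟩ ⟨hb, hb'⟩
    refine ⟨A.mul_mem ha hb, ?_⟩
    have h1 := B.mul_mem ha' hb'
    have h2 : b⁻¹ * (a⁻¹ * (t * a * t⁻¹)) = a⁻¹ * (t * a * t⁻¹) * b⁻¹ :=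
      setLike_mul_comm (A.inv_mem hb) (hBA ha')
    rw [← mul_assoc, ← h2] at h1
    simpa [mul_assoc] using h1
  inv_mem' := by
    rintro a ⟨ha, ha'⟩
    refine ⟨A.inv_mem ha, ?_⟩
    have h1 := B.inv_mem ha'
    have h2 : a * (a⁻¹ * (t * a * t⁻¹))⁻¹ = (a⁻¹ * (t * a * t⁻¹))⁻¹ * a :=
      setLike_mul_comm ha (hBA h1)
    have h3 : a⁻¹⁻¹ * (t * a⁻¹ * t⁻¹) = a * (a⁻¹ * (t * a * t⁻¹))⁻¹ * a⁻¹ := by group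
    rwa [h3, h2, mul_inv_cancel_right]

/-- Since `t` centralizes `B`, whether `a⁻¹ * (t * a * t⁻¹) ∈ B` depends only on the coset of `a`.
The fixed cosets are thus the image of `fixedSubgroup` in `A / B`. -/
theorem card_fixedCosets {A B : Subgroup G} [IsMulCommutative A] (hBA : B ≤ A) {t : G}
    (htA : t ∈ Subgroup.normalizer (A : Set G)) (htB : B ≤ Subgroup.centralizer {t}) :
    Nat.card (fixedCosets A B t) = B.relIndex (fixedSubgroup A B hBA t) := by
  have hnormal : (B.subgroupOf A).Normal :=
    ⟨fun b hb a => by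
      have : a * b = b * a := Subtype.ext (setLike_mul_comm a.2 b.2)
      rwa [this, mul_inv_cancel_right]⟩
  have hle : fixedSubgroup A B hBA t ≤ A := fun a ha => ha.1
  have key : fixedCosets A B t =
      ((((fixedSubgroup A B hBA t).subgroupOf A).map (QuotientGroup.mk' (B.subgroupOf A)) :
        Subgroup (A ⧸ B.subgroupOf A)) : Set (A ⧸ B.subgroupOf A)) := by
    ext c
    constructor
    · obtain ⟨a, rfl⟩ := QuotientGroup.mk_surjective c
      intro h
      obtain ⟨b, hb, hba⟩ := h a rfl
      refine ⟨a, ⟨a.2, ?_⟩, rfl⟩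
      have := QuotientGroup.eq.1 hba.symm
      rw [Subgroup.mem_subgroupOf] at this
      rwa [Subgroup.coe_mul, hb] at this
    · rintro ⟨a, ⟨ha, ha'⟩, rfl⟩ a' haa'
      have hmem (x : A) : t * x * t⁻¹ ∈ A := (Subgroup.mem_normalizer_iff.1 htA x).1 x.2
      refine ⟨⟨_, hmem a'⟩, rfl, ?_⟩
      refine Eq.trans ?_ haa'
      have h1 : (a : G)⁻¹ * a' ∈ B := Subgroup.mem_subgroupOf.1 (QuotientGroup.eq.1 haa'.symm)
      have h2 : a' ∈ (fixedSubgroup A B hBA t).subgroupOf A := by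
        rw [Subgroup.mem_subgroupOf, ← mul_inv_cancel_left (a : G) a']
        refine Subgroup.mul_mem _ ⟨ha, ha'⟩ ⟨hBA h1, ?_⟩
        have := Subgroup.mem_centralizer_singleton_iff.1 (htB h1)
        rw [← this]
        simp
      refine (QuotientGroup.eq.2 ?_).symm
      exact Subgroup.mem_subgroupOf.2 h2.2
  have := Subgroup.relIndex_ker (QuotientGroup.mk' (B.subgroupOf A))
    (K := (fixedSubgroup A B hBA t).subgroupOf A)
  rw [QuotientGroup.ker_mk', Subgroup.relIndex_subgroupOf hle] at this
  rw [this, key]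
  rfl

/-! ### The sets of fused subgroups and elements, and the case where `A` is not weakly closed. -/

namespace FusionSystem

variable {S : Subgroup G} {F : FusionSystem S} {A B P Q R K L U Z P' Q' K' : Subgroup G}
  {f g : G → G} {p : ℕ} {t : G}

theorem hom_nonempty_iff (hA : A ≤ S) :
    (F.Hom U A).Nonempty ↔ ∃ f K, F.Realizes f U K ∧ K ≤ A := by
  constructor
  · rintro ⟨φ, hφ⟩
    obtain ⟨f, K, hK, hf, -⟩ := exists_realizes_of_mem_hom hφ
    exact ⟨f, K, hf, hK⟩
  · rintro ⟨f, K, hf, hK⟩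
    obtain ⟨φ, hφ, -⟩ := hf.exists_mem_hom hK hA
    exact ⟨φ, hφ⟩

theorem mem_fusingSubgroups_iff (hA : A ≤ S) :
    U ∈ F.fusingSubgroups A ↔
      U ≤ normalizerIn S A ∧ ¬ U ≤ A ∧ ∃ f K, F.Realizes f U K ∧ K ≤ A := by
  rw [← hom_nonempty_iff hA]
  refine ⟨fun h => h.2, fun h => ⟨?_, h⟩⟩
  rintro rfl
  exact h.2.1 bot_le

theorem mem_fusingElements_iff (hA : A ≤ S) :
    t ∈ F.fusingElements A ↔
      t ∈ normalizerIn S A ∧ t ∉ A ∧ Subgroup.zpowers t ∈ F.fusingSubgroups A := by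
  rw [mem_fusingSubgroups_iff hA]
  constructor
  · rintro ⟨htN, htA, y, ⟨φ, hφ, -⟩, hy⟩
    refine ⟨htN, htA, by simpa using htN, by simpa using htA, ?_⟩
    obtain ⟨f, K, hK, hf, -⟩ := exists_realizes_of_mem_hom hφ
    exact ⟨f, K, hf, hK.trans (by simpa using hy)⟩
  · rintro ⟨htN, htA, -, -, f, K, hf, hKA⟩
    refine ⟨htN, htA, f t, ?_, hKA (hf.map_mem (Subgroup.mem_zpowers t))⟩
    obtain ⟨φ, -, hφf⟩ := id hf
    have hK : K ≤ Subgroup.zpowers (f t) := by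
      intro y hy
      obtain ⟨⟨x, hx⟩, hxy⟩ := φ.surjective ⟨y, hy⟩
      obtain ⟨k, rfl⟩ := Subgroup.mem_zpowers_iff.1 hx
      have : φ ⟨t ^ k, hx⟩ = φ ⟨t, Subgroup.mem_zpowers t⟩ ^ k := by
        rw [← map_zpow]
        rfl
      refine Subgroup.mem_zpowers_iff.2 ⟨k, ?_⟩
      rw [← hφf ⟨t, Subgroup.mem_zpowers t⟩, ← Subgroup.coe_zpow, ← this, hxy]
    obtain ⟨ψ, hψ, hψf⟩ := hf.exists_mem_hom hK ((Subgroup.zpowers_le).2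
      (hf.le_right (hf.map_mem (Subgroup.mem_zpowers t))))
    exact ⟨ψ, hψ, hψf _⟩

theorem mem_fusingElements_of_mem (hA : A ≤ S) (hU : U ∈ F.fusingSubgroups A) (ht : t ∈ U)
    (htA : t ∉ A) : t ∈ F.fusingElements A := by
  have hU' := (mem_fusingSubgroups_iff hA).1 hU
  obtain ⟨hUN, -, f, K, hf, hK⟩ := hU'
  have htU : Subgroup.zpowers t ≤ U := (Subgroup.zpowers_le).2 ht
  obtain ⟨K', hK', h⟩ := hf.restrict htU
  exact (mem_fusingElements_iff hA).2 ⟨hUN ht, htA, (mem_fusingSubgroups_iff hA).2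
    ⟨htU.trans hUN, by simpa using htA, f, K', h, hK'.trans hK⟩⟩

/-- An injective extension that maps `A` onto `A` cannot send an element outside `A` into `A`. -/
theorem fusingSubgroups_eq_empty_of_isNormal (hA : F.IsNormal A) : F.fusingSubgroups A = ∅ := by
  refine Set.eq_empty_iff_forall_notMem.2 ?_
  rintro U ⟨-, -, hUA, φ, hφ⟩
  obtain ⟨Q', R', ψ, hψ, ⟨hle, hψφ⟩, hAQ, hmap⟩ := hA U A φ hφ
  refine hUA fun u hu => ?_
  have h1 : (φ ⟨u, hu⟩ : G) ∈ ((A.subgroupOf Q').map ψ).map R'.subtype := by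
    rw [hmap]
    exact (φ ⟨u, hu⟩).2
  obtain ⟨_, ⟨a, ha, rfl⟩, h2⟩ := h1
  have h3 : ψ a = ψ (Subgroup.inclusion hle ⟨u, hu⟩) := Subtype.ext (h2.trans (hψφ _).symm)
  rw [F.injective_of_mem hψ h3] at ha
  exact ha

/-- Take `V = a P a⁻¹` with `a` normalizing `N_S(P)` but not `P`: both `P` and `V` are then normal
in `N_S(P)`. -/
theorem exists_conj_mutually_normalizing [Fact p.Prime] [Finite S] (hS : IsPGroup p S) (hP : P ≤ S)
    (h : ¬ S ≤ Subgroup.normalizer (P : Set G)) :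
    ∃ V ∈ F.conjClass P, V ≠ P ∧ V ≤ normalizerIn S P ∧ P ≤ Subgroup.normalizer (V : Set G) := by
  obtain ⟨a, ha, haN, hanorm⟩ := exists_mem_normalizer_notMem hS (P := normalizerIn S P) (A := S)
    inf_le_left le_rfl (inf_le_left.trans Subgroup.le_normalizer) fun h' => h (h'.trans inf_le_right)
  have hPN : P ≤ normalizerIn S P := le_inf hP Subgroup.le_normalizer
  refine ⟨_, (realizes_conj hP ha).mem_conjClass, fun heq => ?_, ?_, ?_⟩
  · exact haN ⟨ha, Subgroup.mem_normalizer_iff_map_conj_eq.2 heq⟩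
  · rintro _ ⟨x, hx, rfl⟩
    exact (Subgroup.mem_normalizer_iff.1 hanorm x).1 (hPN hx)
  · refine le_normalizer_of_conj_mem ?_
    rintro x hx _ ⟨y, hy, rfl⟩
    have h1 := ((Subgroup.mem_normalizer_iff''.1 hanorm x).1 (hPN hx)).2
    refine ⟨_, (Subgroup.mem_normalizer_iff.1 h1 y).1 hy, ?_⟩
    simp [mul_assoc]

theorem Realizes.le_normalizer (h : F.Realizes g K K') (hPK : P ≤ K) (hQK : Q ≤ K)
    (hPQ : P ≤ Subgroup.normalizer (Q : Set G)) (hP : F.Realizes g P P') (hQ : F.Realizes g Q Q') :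
    P' ≤ Subgroup.normalizer (Q' : Set G) := by
  refine le_normalizer_of_conj_mem fun x' hx' y' hy' => ?_
  obtain ⟨x, hx, rfl⟩ := hP.bijOn.surjOn hx'
  obtain ⟨y, hy, rfl⟩ := hQ.bijOn.surjOn hy'
  rw [← h.map_conj (hPK hx) (hQK hy)]
  exact hQ.map_mem ((Subgroup.mem_normalizer_iff.1 (hPQ hx) y).1 hy)

theorem IsSaturated.exists_mutually_normalizing [Fact p.Prime] [Finite S] (hS : IsPGroup p S)
    (hF : F.IsSaturated p) (hAS : A ≤ S) (hA : ¬ F.IsWeaklyClosed A) :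
    ∃ U ∈ F.conjClass A, U ≠ A ∧ U ≤ Subgroup.normalizer (A : Set G) ∧
      A ≤ Subgroup.normalizer (U : Set G) := by
  by_cases hnorm : S ≤ Subgroup.normalizer (A : Set G)
  · obtain ⟨U, hU, hUA⟩ : ∃ U ∈ F.conjClass A, U ≠ A := by
      by_contra! h
      exact hA (Set.eq_singleton_iff_unique_mem.2 ⟨(realizes_id hAS).mem_conjClass, h⟩)
    have hUS : U ≤ S := le_of_mem_conjClass hU
    by_cases hU' : S ≤ Subgroup.normalizer (U : Set G)
    · exact ⟨U, hU, hUA, hUS.trans hnorm, hAS.trans hU'⟩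
    -- Here `A` is normal in `S` but its conjugate `U` is not. A morphism on `N_S(U)` taking `U` to
    -- `A` carries a pair `U`, `V` of mutually normalizing conjugates to the pair `A`, `W`.
    · have hAn : F.IsFullyNormalized A := by
        refine ⟨hAS, fun Q _ => ?_⟩
        rw [show normalizerIn S A = S from inf_eq_left.2 hnorm]
        exact Subgroup.card_le_of_le inf_le_left
      obtain ⟨g, N, hg, hgU⟩ := hF.exists_realizes_normalizerIn hS hAn (conjClass_symm hU)
      obtain ⟨V, hV, hVU, hVN, hUV⟩ := exists_conj_mutually_normalizing (F := F) hS hUS hU'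
      obtain ⟨W, -, hW⟩ := hg.restrict hVN
      have hUN : U ≤ normalizerIn S U := le_inf hUS Subgroup.le_normalizer
      refine ⟨W, conjClass_trans hU (conjClass_trans hV hW.mem_conjClass), ?_,
        hW.le_right.trans hnorm, hg.le_normalizer hUN hVN hUV hgU hW⟩
      rintro rfl
      exact hVU (SetLike.coe_injective
        ((hg.bijOn.injOn.image_eq_image_iff hVN hUN).1 (hW.image_eq.trans hgU.image_eq.symm)))
  · obtain ⟨V, hV, hVA, hVN, hAV⟩ := exists_conj_mutually_normalizing (F := F) hS hAS hnorm
    exact ⟨V, hV, hVA, hVN.trans inf_le_right, hAV⟩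

theorem exists_fusingTriples_of_not_isWeaklyClosed [Fact p.Prime] [Finite S] (hS : IsPGroup p S)
    (hF : F.IsSaturated p) (hAS : A ≤ S) [IsMulCommutative A] (hA : ¬ F.IsWeaklyClosed A) :
    ∃ U ∈ F.conjClass A, U ≠ A ∧ ⁅U, A⁆ ≤ U ⊓ A ∧
        ∀ t ∈ U, t ∉ A → (t, U, U ⊓ A) ∈ F.fusingTriples A := by
  obtain ⟨U, hU, hUA, hUN, hAN⟩ := hF.exists_mutually_normalizing hS hAS hA
  obtain ⟨f, hf⟩ := mem_conjClass_iff_exists_realizes.1 (conjClass_symm hU)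
  have hcomm : ∀ u ∈ U, ∀ a ∈ A, u * a * u⁻¹ * a⁻¹ ∈ U ⊓ A := by
    intro u hu a ha
    refine ⟨?_, A.mul_mem ((Subgroup.mem_normalizer_iff.1 (hUN hu) a).1 ha) (A.inv_mem ha)⟩
    simpa [mul_assoc] using
      U.mul_mem hu ((Subgroup.mem_normalizer_iff.1 (hAN ha) u⁻¹).1 (U.inv_mem hu))
  have hfin : ∀ {K : Subgroup G}, K ≤ S → Finite K := fun h =>
    Finite.of_injective _ (Subgroup.inclusion_injective h)
  have := hfin hAS
  have := hfin (inf_le_right.trans hAS : U ⊓ A ≤ S)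
  refine ⟨U, hU, hUA, Subgroup.commutator_le.2 hcomm, fun t ht htA => ?_⟩
  have hUfus : U ∈ F.fusingSubgroups A := (mem_fusingSubgroups_iff hAS).2
    ⟨le_inf hf.le_left hUN, fun h => htA (h ht), f, A, hf, le_rfl⟩
  have htU : U ⊓ A ≤ Subgroup.centralizer {t} := fun x hx =>
    Subgroup.mem_centralizer_singleton_iff.2 (hf.commute hx.1 ht)
  refine ⟨mem_fusingElements_of_mem hAS hUfus ht htA, hUfus, le_inf inf_le_right htU,
    (realizes_id (inf_le_right.trans hAS)).mem_conjClass, ?_⟩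
  -- As `[t, A] ≤ U ∩ A`, every coset is fixed, so both sides of the count are determined by `|U| =
  -- |A|`.
  have hfix : fixedSubgroup A (U ⊓ A) inf_le_right t = A := by
    refine le_antisymm (fun x hx => hx.1) fun x hx => ⟨hx, ?_⟩
    have h1 := hcomm t ht x hx
    rwa [setLike_mul_comm (A.inv_mem hx) ((Subgroup.mem_normalizer_iff.1 (hUN ht) x).1 hx)]
  change A.relIndex (U ⊔ A) = _
  rw [card_fixedCosets inf_le_right (hUN ht) htU, hfix, relIndex_sup_right_of_le_normalizer hUN,
    ← Subgroup.inf_relIndex_left]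
  exact relIndex_eq_of_card_eq inf_le_left inf_le_right rfl hf.card_eq

end FusionSystem

end

/-! ### Weakly closed `A`: constructing fusing triples. -/

section

variable {G : Type*} [Group G]

namespace FusionSystem

variable {S : Subgroup G} {F : FusionSystem S} {A B P Q R K L U Z P' Q' K' : Subgroup G}
  {f g : G → G} {p : ℕ} {t : G}

theorem Realizes.le_centralizer_of_le (h : F.Realizes f K K') [IsMulCommutative A] (hA : K' ≤ A)
    (hP : P ≤ K) : K ≤ Subgroup.centralizer (P : Set G) := fun x hx =>
  Subgroup.mem_centralizer_iff.2 fun y hy => h.bijOn.injOn (K.mul_mem (hP hy) hx)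
    (K.mul_mem hx (hP hy)) (by
      rw [h.map_mul (hP hy) hx, h.map_mul hx (hP hy)]
      exact setLike_mul_comm (hA (h.map_mem (hP hy))) (hA (h.map_mem hx)))

namespace IsWeaklyClosed

theorem realizes (hA : F.IsWeaklyClosed A) (h : F.Realizes f K K') (hK : A ≤ K) :
    F.Realizes f A A := by
  obtain ⟨B, -, hB⟩ := h.restrict hK
  have : B ∈ F.conjClass A := hB.mem_conjClass
  rw [show F.conjClass A = {A} from hA] at this
  rwa [Set.mem_singleton_iff.1 this] at hB

theorem le_normalizer (hA : F.IsWeaklyClosed A) (hAS : A ≤ S) :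
    S ≤ Subgroup.normalizer (A : Set G) :=
  le_normalizer_of_conj_mem fun _ hs _ hx => (hA.realizes (realizes_conj hAS hs) le_rfl).map_mem hx

theorem mem_of_map_mem (hgA : F.Realizes g A A) (hg : F.Realizes g K K') (hAK : A ≤ K) {x : G}
    (hx : x ∈ K) (hgx : g x ∈ A) : x ∈ A := by
  obtain ⟨a, ha, hga⟩ := hgA.bijOn.surjOn hgx
  rwa [← hg.bijOn.injOn (hAK ha) hx hga]

variable [IsMulCommutative A]

/-- An isomorphism from a subgroup of `A` to a fully centralized subgroup extends to the centralizer,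
and the extension maps `A` to itself. -/
theorem exists_extension (hF : F.IsSaturated p) (hA : F.IsWeaklyClosed A) (hAS : A ≤ S) (hP : P ≤ A)
    (hf : F.Realizes f P Q) (hQ : F.IsFullyCentralized Q) :
    ∃ g K', F.Realizes g (centralizerIn S P) K' ∧ F.Realizes g A A ∧ (∀ x ∈ P, g x = f x) ∧
      Q ≤ A ∧ A ≤ centralizerIn S P := by
  obtain ⟨g, K', hg, hgf⟩ := hF.exists_extension_centralizerIn hf hQ
  have hAC : A ≤ centralizerIn S P :=
    le_inf hAS ((realizes_id (F := F) hAS).le_centralizer_of_le le_rfl hP)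
  have hgA := hA.realizes hg hAC
  refine ⟨g, K', hg, hgA, hgf, fun y hy => ?_, hAC⟩
  obtain ⟨x, hx, rfl⟩ := hf.bijOn.surjOn hy
  rw [← hgf x hx]
  exact hgA.map_mem (hP hx)

/-- Otherwise `A` would be strongly closed: an image `f x ∉ A` of some `x ∈ A` is itself a fusing
element, through the inverse of `f`. -/
theorem nonempty_fusingElements [Fact p.Prime] [Finite S] (hS : IsPGroup p S) (hF : F.IsSaturated p)
    (hW : F.IsWeaklyClosed A) (hAS : A ≤ S) (hA : ¬ F.IsNormal A) :
    (F.fusingElements A).Nonempty := by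
  by_contra hne
  refine hA (IsStronglyClosed.isNormal hS hF (fun P Q φ hφ x hxA => ?_) hAS)
  by_contra hfx
  obtain ⟨f, R, -, hf, hφf⟩ := exists_realizes_of_mem_hom hφ
  rw [hφf] at hfx
  obtain ⟨T, -, hT⟩ := hf.restrict ((Subgroup.zpowers_le).2 x.2)
  obtain ⟨g, hg, -, -⟩ := hT.symm
  have hmem : f x ∈ T := hT.map_mem (Subgroup.mem_zpowers _)
  exact hne ⟨f x, mem_fusingElements_of_mem hAS ((mem_fusingSubgroups_iff hAS).2
    ⟨le_inf hT.le_right (hT.le_right.trans (hW.le_normalizer hAS)), fun h => hfx (h hmem), g, _, hg,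
      (Subgroup.zpowers_le).2 hxA⟩) hmem hfx⟩

/-- The subgroup `U` is the image of `D = fixedSubgroup A B hBA t` under a morphism on `N_S(P)`,
where `P = ⟨t⟩B`. The inverse morphism fuses `U` back into `A`. The maximality of `B` is stated as
`hmax` so that the lemma serves two different choices of `B`. -/
theorem exists_fusingSubgroups_of_maximal [Fact p.Prime] [Finite S] (hS : IsPGroup p S)
    (hF : F.IsSaturated p) (hW : F.IsWeaklyClosed A) (hAS : A ≤ S) (htA : t ∉ A) (hBA : B ≤ A)
    (htB : B ≤ Subgroup.centralizer {t}) (hf : F.Realizes f (Subgroup.zpowers t ⊔ B) K') (hK' : K' ≤ A)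
    (hmax : ∀ (f : G → G) (K K' : Subgroup G), Subgroup.zpowers t ⊔ B ≤ K → F.Realizes f K K' →
      K' ≤ A → K ⊓ A ≤ B) :
    ∃ U ∈ F.fusingSubgroups A, B ∈ F.conjClass (U ⊓ A) ∧
      A.relIndex (U ⊔ A) = Nat.card (fixedCosets A B t) := by
  have hSA := hW.le_normalizer hAS
  set P := Subgroup.zpowers t ⊔ B with hPdef
  have htP : t ∈ P := Subgroup.mem_sup_left (Subgroup.mem_zpowers t)
  have hBP : B ≤ P := le_sup_right
  have htS : t ∈ S := hf.le_left htP
  have hfin : ∀ {K : Subgroup G}, K ≤ S → Finite K := fun h =>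
    Finite.of_injective _ (Subgroup.inclusion_injective h)
  obtain ⟨R, hR, hRn⟩ := F.exists_isFullyNormalized hf.le_left
  obtain ⟨f', hf'⟩ := mem_conjClass_iff_exists_realizes.1
    (conjClass_trans (conjClass_symm hf.mem_conjClass) hR)
  obtain ⟨-, -, -, -, -, hRA, -⟩ := hW.exists_extension hF hAS hK' hf' (hF.sylow_axiom R hRn.1 hRn).1
  obtain ⟨g, N, hg, hgP⟩ := hF.exists_realizes_normalizerIn hS hRn hR
  have hPN : P ≤ normalizerIn S P := le_inf hf.le_left Subgroup.le_normalizer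
  set D := fixedSubgroup A B hBA t with hD
  have hDP : D ≤ normalizerIn S P := by
    refine le_inf (fun x hx => hAS hx.1) (le_normalizer_of_conj_mem fun x hx y hy => ?_)
    have hle : P ≤ P.comap (MulAut.conj x).toMonoidHom := by
      refine sup_le ((Subgroup.zpowers_le).2 ?_) fun b hb => ?_
      · have h1 := P.mul_mem (hBP (D.inv_mem hx).2) htP
        rw [Subgroup.mem_comap]
        simpa [mul_assoc] using h1
      · rw [Subgroup.mem_comap]
        change x * b * x⁻¹ ∈ P
        rw [setLike_mul_comm hx.1 (hBA hb), mul_inv_cancel_right]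
        exact hBP hb
    exact hle hy
  -- The preimage of `A` under `g` contains `P`, since `g` maps `P` onto `R ≤ A`. So `hmax` applies
  -- to it.
  have hmem : ∀ x ∈ normalizerIn S P, x ∈ A → g x ∈ A → x ∈ B := by
    intro x hx hxA hgx
    obtain ⟨K, hK, hKg, hKmem⟩ := hg.exists_preimage (inf_le_left : N ⊓ A ≤ N)
    refine hmax g K _ (fun y hy => hKmem y (hPN hy) ?_) hKg inf_le_right
      ⟨hKmem x hx ⟨hg.map_mem hx, hgx⟩, hxA⟩
    exact ⟨hg.map_mem (hPN hy), hRA (hgP.map_mem hy)⟩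
  have hBD : B ≤ D := fun b hb => by
    refine ⟨hBA hb, ?_⟩
    rw [← Subgroup.mem_centralizer_singleton_iff.1 (htB hb)]
    simp
  obtain ⟨U, -, hU⟩ := hg.restrict hDP
  obtain ⟨g', hg', -, -⟩ := hU.symm
  have hUA : F.Realizes g B (U ⊓ A) := by
    refine hU.restrict_of_image_eq hBD (Set.Subset.antisymm ?_ ?_)
    · rintro _ ⟨b, hb, rfl⟩
      exact ⟨hU.map_mem (hBD hb), hRA (hgP.map_mem (hBP hb))⟩
    · rintro u ⟨hu, huA⟩
      obtain ⟨x, hx, rfl⟩ := hU.bijOn.surjOn hu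
      exact ⟨x, hmem x (hDP hx) hx.1 huA, rfl⟩
  -- If `U ≤ A`, then `D ≤ B`. An `a ∈ A ∖ P` normalizing `P` would have its commutator with `t` in
  -- `P ∩ A ≤ B`, hence lie in `D ≤ B ≤ P`. So `A ≤ P`, and comparing orders gives `P = A`, against
  -- `t ∉ A`.
  have hU_not_le : ¬ U ≤ A := by
    intro h
    have hDB : D ≤ B := fun x hx => hmem x (hDP hx) hx.1 (h (hU.map_mem hx))
    have hAP : A ≤ P := by
      by_contra hAP
      obtain ⟨a, ha, haP, haN⟩ := exists_mem_normalizer_notMem hS hf.le_left hAS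
        (hf.le_left.trans hSA) hAP
      have h1 : a⁻¹ * (t * a * t⁻¹) ∈ P := by
        have := P.mul_mem ((Subgroup.mem_normalizer_iff''.1 haN t).1 htP) (P.inv_mem htP)
        simpa [mul_assoc] using this
      have h2 : a⁻¹ * (t * a * t⁻¹) ∈ A :=
        A.mul_mem (A.inv_mem ha) ((Subgroup.mem_normalizer_iff.1 (hSA htS) a).1 ha)
      exact haP (hBP (hDB ⟨ha, hmax f P K' le_rfl hf hK' ⟨h1, h2⟩⟩))
    have := hfin hf.le_left
    have hcard : Nat.card P ≤ Nat.card A := by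
      have := hfin hAS
      rw [hf.card_eq]
      exact Subgroup.card_le_of_le hK'
    rw [Subgroup.eq_of_le_of_card_ge hAP hcard] at htA
    exact htA htP
  have hUN : U ≤ Subgroup.normalizer (A : Set G) := hU.le_right.trans hSA
  refine ⟨U, (mem_fusingSubgroups_iff hAS).2 ⟨le_inf hU.le_right hUN, hU_not_le, g', D, hg',
    fun x hx => hx.1⟩, conjClass_symm hUA.mem_conjClass, ?_⟩
  have := hfin hUA.le_right
  rw [card_fixedCosets hBA (hSA htS) htB, relIndex_sup_right_of_le_normalizer hUN,
    ← Subgroup.inf_relIndex_left]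
  exact relIndex_eq_of_card_eq inf_le_left hBD hUA.card_eq.symm hU.card_eq.symm

theorem exists_fusingTriples [Fact p.Prime] [Finite S] (hS : IsPGroup p S)
    (hF : F.IsSaturated p) (hW : F.IsWeaklyClosed A) (hAS : A ≤ S) (ht : t ∈ F.fusingElements A) :
    ∃ U ∈ F.fusingSubgroups A, ∃ B ≤ A, (t, U, B) ∈ F.fusingTriples A := by
  have ht' := (mem_fusingElements_iff hAS).1 ht
  obtain ⟨-, htA, htU⟩ := ht'
  obtain ⟨-, -, f₀, K₀, hf₀, hK₀⟩ := (mem_fusingSubgroups_iff hAS).1 htU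
  -- A member of `C` of largest order is maximal as required: a subgroup `L` above `⟨t⟩B` fused into
  -- `A` is abelian, so `L ∩ A` centralizes `t` and again belongs to `C`.
  let C : Set (Subgroup G) := {B | B ≤ A ∧ B ≤ Subgroup.centralizer {t} ∧
    ∃ f K', F.Realizes f (Subgroup.zpowers t ⊔ B) K' ∧ K' ≤ A}
  have := Finite.of_injective _ (Subgroup.inclusion_injective hAS)
  have hne : ((fun B : Subgroup G => Nat.card B) '' C).Nonempty :=
    ⟨_, ⊥, ⟨bot_le, bot_le, f₀, K₀, by rwa [sup_bot_eq], hK₀⟩, rfl⟩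
  have hbdd : BddAbove ((fun B : Subgroup G => Nat.card B) '' C) := by
    refine ⟨Nat.card A, ?_⟩
    rintro _ ⟨B, hB, rfl⟩
    exact Subgroup.card_le_of_le hB.1
  obtain ⟨B, ⟨hBA, htB, f, K', hf, hK'⟩, hBmax⟩ := Nat.sSup_mem hne hbdd
  obtain ⟨U, hU, hBU, hcard⟩ := hW.exists_fusingSubgroups_of_maximal hS hF hAS htA hBA htB hf hK' (by
    intro g L L' hL hg hL'
    have htL : Subgroup.zpowers t ≤ L := le_sup_left.trans hL
    have hBL : B ≤ L ⊓ A := le_inf (le_sup_right.trans hL) hBA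
    obtain ⟨T, hT, hgT⟩ := hg.restrict (sup_le htL inf_le_left : Subgroup.zpowers t ⊔ (L ⊓ A) ≤ L)
    have hLC : L ⊓ A ∈ C := by
      refine ⟨inf_le_right, fun x hx => ?_, g, T, hgT, hT.trans hL'⟩
      exact Subgroup.mem_centralizer_singleton_iff.2 (Subgroup.mem_centralizer_iff.1
        (hg.le_centralizer_of_le hL' le_rfl (htL (Subgroup.mem_zpowers t))) x hx.1)
    have := Finite.of_injective _ (Subgroup.inclusion_injective (inf_le_right : L ⊓ A ≤ A))
    exact (Subgroup.eq_of_le_of_card_ge hBL ((le_csSup hbdd ⟨_, hLC, rfl⟩).trans hBmax.ge)).ge)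
  exact ⟨U, hU, B, hBA, ht, hU, le_inf hBA htB, hBU, hcard⟩

/-- A member of `U_F(A)` can be moved so that its intersection with `A` becomes a prescribed fully
centralized subgroup. -/
theorem exists_fusingSubgroups_inf_eq (hF : F.IsSaturated p) (hW : F.IsWeaklyClosed A)
    [Finite S] (hAS : A ≤ S) (hU : U ∈ F.fusingSubgroups A) (hZ : F.IsFullyCentralized Z)
    (hZU : Z ∈ F.conjClass (U ⊓ A)) :
    ∃ V ∈ F.fusingSubgroups A, V ⊓ A = Z ∧ A.relIndex (V ⊔ A) = A.relIndex (U ⊔ A) := by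
  have hSA := hW.le_normalizer hAS
  obtain ⟨hUN, hUA, k, K, hk, hKA⟩ := (mem_fusingSubgroups_iff hAS).1 hU
  obtain ⟨f, hf⟩ := mem_conjClass_iff_exists_realizes.1 hZU
  obtain ⟨g, C, hg, hgA, hgf, hZA, hAC⟩ := hW.exists_extension hF hAS inf_le_right hf hZ
  have hUC : U ≤ centralizerIn S (U ⊓ A) := le_inf hk.le_left (hk.le_centralizer_of_le hKA inf_le_left)
  -- `U` is abelian, so it lies in the domain `C_S(U ∩ A)` of `g`. As `g` maps `A` onto `A`, it
  -- carries `U ∩ A` to `V ∩ A`.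
  obtain ⟨V, -, hV⟩ := hg.restrict hUC
  obtain ⟨g', hg', -, -⟩ := hV.symm
  have hmem : ∀ u ∈ U, g u ∈ A → u ∈ A := fun u hu => mem_of_map_mem hgA hg hAC (hUC hu)
  have hVA : V ⊓ A = Z := by
    refine SetLike.coe_injective (Set.Subset.antisymm ?_ ?_)
    · rintro v ⟨hv, hvA⟩
      obtain ⟨u, hu, rfl⟩ := hV.bijOn.surjOn hv
      have : u ∈ U ⊓ A := ⟨hu, hmem u hu hvA⟩
      rw [hgf u this]
      exact hf.map_mem this
    · intro z hz
      refine ⟨?_, hZA hz⟩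
      obtain ⟨u, hu, rfl⟩ := hf.bijOn.surjOn hz
      rw [← hgf u hu]
      exact hV.map_mem hu.1
  have hVN : V ≤ Subgroup.normalizer (A : Set G) := hV.le_right.trans hSA
  refine ⟨V, (mem_fusingSubgroups_iff hAS).2 ⟨le_inf hV.le_right hVN,
    fun h => hUA fun u hu => hmem u hu (h (hV.map_mem hu)), _, K, hk.comp hg', hKA⟩, hVA, ?_⟩
  have := Finite.of_injective _ (Subgroup.inclusion_injective hf.le_right)
  rw [relIndex_sup_right_of_le_normalizer hVN,
    relIndex_sup_right_of_le_normalizer (hUN.trans inf_le_right), ← Subgroup.inf_relIndex_left V,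
    ← Subgroup.inf_relIndex_left U, hVA]
  exact relIndex_eq_of_card_eq (hVA ▸ inf_le_left) inf_le_left hf.card_eq.symm hV.card_eq.symm

end IsWeaklyClosed

end FusionSystem

end

/-! ### Centralizer fusion systems and the choice of `Z`. -/

section

variable {G : Type*} [Group G]

namespace FusionSystem

variable {S : Subgroup G} {F : FusionSystem S} {A B P Q R K L U Z P' Q' K' : Subgroup G}
  {f g : G → G} {p : ℕ} {t : G}

theorem mem_hom_of_mem_centralizer_hom {hZ : Z ≤ S} {φ : P →* Q}
    (hφ : φ ∈ (F.centralizer Z hZ).Hom P Q) : φ ∈ F.Hom P Q := by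
  obtain ⟨-, hQ, ψ, hψ, ⟨hle, h⟩, -⟩ := hφ
  obtain ⟨f, K, -, hf, hψf⟩ := exists_realizes_of_mem_hom hψ
  obtain ⟨L, -, hL⟩ := hf.restrict hle
  have hφf (x : P) : (φ x : G) = f x := (h x).symm.trans (hψf _)
  have hLQ : L ≤ Q := fun y hy => by
    obtain ⟨x, hx, rfl⟩ := hL.bijOn.surjOn hy
    rw [← hφf ⟨x, hx⟩]
    exact (φ _).2
  obtain ⟨φ', hφ', hφ'f⟩ := hL.exists_mem_hom hLQ (hQ.trans inf_le_left)
  rwa [show φ = φ' from MonoidHom.ext fun x => Subtype.ext ((hφf x).trans (hφ'f x).symm)]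

theorem conjClass_centralizer_subset {hZ : Z ≤ S} :
    (F.centralizer Z hZ).conjClass P ⊆ F.conjClass P := fun _ ⟨φ, hφ⟩ =>
  ⟨φ, mem_hom_of_mem_centralizer_hom hφ.1, mem_hom_of_mem_centralizer_hom hφ.2⟩

theorem normalizerIn_centralizerIn_le : normalizerIn (centralizerIn S Z) A ≤ normalizerIn S A :=
  inf_le_inf_right _ inf_le_left

theorem fusingSubgroups_centralizer_subset {hZ : Z ≤ S} :
    (F.centralizer Z hZ).fusingSubgroups A ⊆ F.fusingSubgroups A :=
  fun _ ⟨h, hN, hA, φ, hφ⟩ =>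
    ⟨h, hN.trans normalizerIn_centralizerIn_le, hA, φ, mem_hom_of_mem_centralizer_hom hφ⟩

theorem fusingElements_centralizer_subset {hZ : Z ≤ S} :
    (F.centralizer Z hZ).fusingElements A ⊆ F.fusingElements A :=
  fun _ ⟨hN, hA, y, ⟨φ, hφ, hφy⟩, hy⟩ =>
    ⟨normalizerIn_centralizerIn_le hN, hA, y, ⟨φ, mem_hom_of_mem_centralizer_hom hφ, hφy⟩, hy⟩

theorem fusingTriples_centralizer_subset {hZ : Z ≤ S} :
    (F.centralizer Z hZ).fusingTriples A ⊆ F.fusingTriples A :=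
  fun _ ⟨ht, hU, hB, hBU, h⟩ =>
    ⟨fusingElements_centralizer_subset ht, fusingSubgroups_centralizer_subset hU, hB,
      conjClass_centralizer_subset hBU, h⟩

/-- Morphisms of `C_F(Z)` fix `Z` pointwise. With `U ∩ A ≤ Z`, this forces `A_* = U ∩ A`. -/
theorem eq_of_mem_conjClass_centralizer {hZ : Z ≤ S} (hP : P ≤ Z)
    (hQ : Q ∈ (F.centralizer Z hZ).conjClass P) : Q = P := by
  obtain ⟨φ, ⟨-, -, ψ, -, ⟨hle, h⟩, hid⟩, -⟩ := hQ
  have hφ (x : P) : (φ x : G) = x := (h x).symm.trans (hid x (hP x.2))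
  ext y
  constructor
  · intro hy
    have := hφ (φ.symm ⟨y, hy⟩)
    rw [φ.apply_symm_apply] at this
    rw [show y = _ from this]
    exact (φ.symm _).2
  · intro hy
    rw [← show _ = y from hφ ⟨y, hy⟩]
    exact (φ _).2

theorem mem_fusingSubgroups_centralizer_iff [IsMulCommutative A] (hA : A ≤ S) {hZ : Z ≤ S}
    (hZA : Z ≤ A) :
    U ∈ (F.centralizer Z hZ).fusingSubgroups A ↔
      U ≤ normalizerIn (centralizerIn S Z) A ∧ ¬ U ≤ A ∧
        ∃ f K, F.Realizes f (U ⊔ Z) K ∧ K ≤ A ∧ ∀ z ∈ Z, f z = z := by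
  have hAC : A ≤ centralizerIn S Z :=
    le_inf hA ((realizes_id (F := F) hA).le_centralizer_of_le le_rfl hZA)
  have hAZ : A ⊔ Z = A := sup_of_le_left hZA
  constructor
  · rintro ⟨-, hN, hUA, φ, -, -, ψ, hψ, -, hid⟩
    obtain ⟨f, K, hK, hf, hψf⟩ := exists_realizes_of_mem_hom hψ
    refine ⟨hN, hUA, f, K, hf, hK.trans hAZ.le, fun z hz => ?_⟩
    rw [← hψf ⟨z, Subgroup.mem_sup_right hz⟩]
    exact hid z hz
  · rintro ⟨hN, hUA, f, K, hf, hKA, hfZ⟩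
    obtain ⟨L, hL, hL'⟩ := hf.restrict (le_sup_left : U ≤ U ⊔ Z)
    obtain ⟨φ, -, hφf⟩ := hL'.exists_mem_hom (hL.trans hKA) hA
    obtain ⟨ψ, hψ, hψf⟩ := hf.exists_mem_hom (hKA.trans hAZ.ge) (hAZ.le.trans hA)
    refine ⟨?_, hN, hUA, φ, hN.trans inf_le_left, hAC, ψ, hψ,
      ⟨le_sup_left, fun x => (hψf _).trans (hφf x).symm⟩, fun z hz => (hψf _).trans (hfZ z hz)⟩
    rintro rfl
    exact hUA bot_le

/-- A subgroup containing `Z` that is conjugate into `A`, by a map that fixes `Z`, lies in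
`U_{C_F(Z)}(A)`. -/
theorem IsWeaklyClosed.mem_fusingSubgroups_centralizer [IsMulCommutative A] (hW : F.IsWeaklyClosed A)
    (hA : A ≤ S) {hZ : Z ≤ S} (hZA : Z ≤ A) (hUA : ¬ U ≤ A) (hZU : Z ≤ U) (hf : F.Realizes f U K)
    (hK : K ≤ A) (hfZ : ∀ z ∈ Z, f z = z) : U ∈ (F.centralizer Z hZ).fusingSubgroups A :=
  (mem_fusingSubgroups_centralizer_iff hA hZA).2
    ⟨le_inf (le_inf hf.le_left (hf.le_centralizer_of_le hK hZU)) (hf.le_left.trans (hW.le_normalizer hA)),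
      hUA, f, K, by rwa [sup_of_le_left hZU], hK, hfZ⟩

theorem isFullyCentralized_bot : F.IsFullyCentralized ⊥ := by
  refine ⟨bot_le, fun Q hQ => ?_⟩
  obtain ⟨φ, -⟩ := hQ
  have : Subsingleton Q := φ.symm.toEquiv.subsingleton
  rw [Subgroup.eq_bot_of_subsingleton Q]

/-- The group `Y = UZ ∩ A` properly contains `Z`. Let `Q` be a fully centralized conjugate of `Y`.
Moving `UZ` by an extension `g` of `ψ : Y → Q` gives a member for `C_F(Q)`. -/
theorem IsWeaklyClosed.exists_larger [IsMulCommutative A] [Finite S] (hF : F.IsSaturated p)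
    (hW : F.IsWeaklyClosed A) (hAS : A ≤ S) (hZA : Z ≤ A) {hZ : Z ≤ S}
    (hU : U ∈ (F.centralizer Z hZ).fusingSubgroups A) (hUZ : ¬ U ⊓ A ≤ Z) :
    ∃ (Q : Subgroup G) (hQ : Q ≤ S), Q ≤ A ∧ F.IsFullyCentralized Q ∧
      ((F.centralizer Q hQ).fusingSubgroups A).Nonempty ∧ Nat.card Z < Nat.card Q := by
  obtain ⟨-, hUA, f, K, hf, hKA, hfZ⟩ := (mem_fusingSubgroups_centralizer_iff hAS hZA).1 hU
  set V := U ⊔ Z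
  set Y := V ⊓ A
  have hZY : Z < Y := (le_inf le_sup_right hZA).lt_of_not_ge fun h =>
    hUZ ((inf_le_inf_right A le_sup_left).trans h)
  have hYS : Y ≤ S := inf_le_right.trans hAS
  obtain ⟨Q, hQ, hQc⟩ := hF.exists_isFullyCentralized hYS
  obtain ⟨ψ, hψ⟩ := mem_conjClass_iff_exists_realizes.1 hQ
  obtain ⟨g, C, hg, hgA, hgψ, hQA, hAC⟩ := hW.exists_extension hF hAS inf_le_right hψ hQc
  obtain ⟨X, hXK, hX⟩ := hf.restrict (inf_le_left : Y ≤ V)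
  obtain ⟨f', hf', hf'f, -⟩ := hX.symm
  -- The map `h` extends `ψ ∘ f⁻¹` on `X = f(Y)`, so `h ∘ f ∘ g⁻¹` sends `W = g(UZ)` into `A` and is
  -- the identity on `Q`.
  obtain ⟨h, C', -, hhA, hhψ, -, -⟩ := hW.exists_extension hF hAS (hXK.trans hKA) (hψ.comp hf') hQc
  have hVC : V ≤ centralizerIn S Y := le_inf hf.le_left (hf.le_centralizer_of_le hKA inf_le_left)
  obtain ⟨W, -, hW'⟩ := hg.restrict hVC
  obtain ⟨k, hk, hkg, -⟩ := hW'.symm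
  obtain ⟨T, hTA, hT⟩ := hhA.restrict hKA
  have hQcard : Nat.card Z < Nat.card Q := by
    have := Finite.of_injective _ (Subgroup.inclusion_injective hYS)
    rw [← hψ.card_eq]
    exact lt_of_not_ge fun h => hZY.ne (Subgroup.eq_of_le_of_card_ge hZY.le h)
  refine ⟨Q, hψ.le_right, hQA, hQc, ⟨W, hW.mem_fusingSubgroups_centralizer hAS hQA (fun hWA => ?_) ?_
    (hT.comp (hf.comp hk)) hTA ?_⟩, hQcard⟩
  · exact hUA fun u hu => mem_of_map_mem hgA hg hAC (hVC (Subgroup.mem_sup_left hu))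
      (hWA (hW'.map_mem (Subgroup.mem_sup_left hu)))
  · intro q hq
    obtain ⟨y, hy, rfl⟩ := hψ.bijOn.surjOn hq
    rw [← hgψ y hy]
    exact hW'.map_mem hy.1
  · intro q hq
    obtain ⟨y, hy, rfl⟩ := hψ.bijOn.surjOn hq
    simp only [Function.comp_apply]
    rw [← hgψ y hy, hkg y hy.1, hhψ _ (hX.map_mem hy), Function.comp_apply, hf'f y hy, hgψ y hy]

/-- The trivial subgroup is a candidate for `Z`, and `exists_larger` shows that a candidate of
largest order works. -/
theorem IsWeaklyClosed.exists_isFullyCentralized_maximal [IsMulCommutative A] [Finite S]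
    (hF : F.IsSaturated p) (hW : F.IsWeaklyClosed A) (hAS : A ≤ S)
    (hne : (F.fusingSubgroups A).Nonempty) :
    ∃ (Z : Subgroup G) (hZ : Z ≤ S), Z ≤ A ∧ F.IsFullyCentralized Z ∧
      ((F.centralizer Z hZ).fusingSubgroups A).Nonempty ∧
      ∀ U ∈ (F.centralizer Z hZ).fusingSubgroups A, U ⊓ A ≤ Z := by
  let C : Set (Subgroup G) := {Z | ∃ hZ : Z ≤ S, Z ≤ A ∧ F.IsFullyCentralized Z ∧
      ((F.centralizer Z hZ).fusingSubgroups A).Nonempty}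
  have hne' : ((fun Z : Subgroup G => Nat.card Z) '' C).Nonempty := by
    obtain ⟨U, hU⟩ := hne
    obtain ⟨-, hUA, f, K, hf, hKA⟩ := (mem_fusingSubgroups_iff hAS).1 hU
    obtain ⟨T, -, hT⟩ := hf.restrict (bot_le : ⊥ ≤ U)
    refine ⟨_, ⊥, ⟨bot_le, bot_le, isFullyCentralized_bot, U,
      hW.mem_fusingSubgroups_centralizer hAS bot_le hUA bot_le hf hKA fun z hz => ?_⟩, rfl⟩
    rw [Subgroup.mem_bot.1 hz]
    have := hf.map_mul U.one_mem U.one_mem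
    rwa [mul_one, left_eq_mul] at this
  have hbdd : BddAbove ((fun Z : Subgroup G => Nat.card Z) '' C) := by
    refine ⟨Nat.card S, ?_⟩
    rintro _ ⟨Z, hZ, rfl⟩
    exact Subgroup.card_le_of_le hZ.1
  obtain ⟨Z, ⟨hZ, hZA, hZc, hZne⟩, hmax⟩ := Nat.sSup_mem hne' hbdd
  refine ⟨Z, hZ, hZA, hZc, hZne, fun U hU => ?_⟩
  by_contra hUZ
  obtain ⟨Q, hQ, hQA, hQc, hQne, hcard⟩ := hW.exists_larger hF hAS hZA hU hUZ
  have := (le_csSup hbdd ⟨Q, ⟨hQ, hQA, hQc, hQne⟩, rfl⟩).trans hmax.ge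
  exact absurd hcard this.not_gt

theorem IsWeaklyClosed.exists_fusingTriples_inf [Fact p.Prime] [IsMulCommutative A] [Finite S]
    (hS : IsPGroup p S) (hF : F.IsSaturated p) (hW : F.IsWeaklyClosed A) (hAS : A ≤ S)
    (hne : (F.fusingSubgroups A).Nonempty) :
    ∃ t ∈ F.fusingElements A, ∃ U ∈ F.fusingSubgroups A, (t, U, U ⊓ A) ∈ F.fusingTriples A := by
  obtain ⟨Z, hZ, hZA, hZc, ⟨U, hU⟩, hmax⟩ := hW.exists_isFullyCentralized_maximal hF hAS hne
  obtain ⟨hUN, hUA, f, K, hf, hKA, hfZ⟩ := (mem_fusingSubgroups_centralizer_iff hAS hZA).1 hU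
  obtain ⟨t, htU, htA⟩ := SetLike.not_le_iff_exists.1 hUA
  have ht : t ∈ F.fusingElements A :=
    mem_fusingElements_of_mem hAS (fusingSubgroups_centralizer_subset hU) htU htA
  have htZ : Z ≤ Subgroup.centralizer {t} := fun z hz => Subgroup.mem_centralizer_singleton_iff.2
    (Subgroup.mem_centralizer_iff.1 (hUN htU).1.2 z hz)
  obtain ⟨T, hTK, hT⟩ := hf.restrict
    (sup_le_sup_right ((Subgroup.zpowers_le).2 htU) Z : Subgroup.zpowers t ⊔ Z ≤ U ⊔ Z)
  obtain ⟨V, hV, hZV, hcard⟩ := hW.exists_fusingSubgroups_of_maximal hS hF hAS htA hZA htZ hT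
    (hTK.trans hKA) (by
      intro g L L' hL hg hL'
      have hZL : Z ≤ L := le_sup_right.trans hL
      have htL : t ∈ L := hL (Subgroup.mem_sup_left (Subgroup.mem_zpowers t))
      obtain ⟨Y, hYL, hY⟩ := hg.restrict hZL
      obtain ⟨k, hk, hkg, -⟩ := hY.symm
      -- The given `g` need not fix `Z`. Since `Z` is fully centralized, the inverse of `g` on `Z`
      -- extends to a map `h` preserving `A`. Then `h ∘ g` fixes `Z` and still lands in `A`, so the
      -- maximality of `Z` applies to `L`.
      obtain ⟨h, C, -, hhA, hhk, -, -⟩ := hW.exists_extension hF hAS (hYL.trans hL') hk hZc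
      obtain ⟨X, hXA, hX⟩ := hhA.restrict hL'
      refine hmax L (hW.mem_fusingSubgroups_centralizer hAS hZA (fun h => htA (h htL)) hZL
        (hX.comp hg) hXA fun z hz => ?_)
      rw [Function.comp_apply, hhk _ (hY.map_mem hz), hkg z hz])
  obtain ⟨W, hW', hWZ, hcard'⟩ := hW.exists_fusingSubgroups_inf_eq hF hAS hV hZc hZV
  refine ⟨t, ht, W, hW', ht, hW', ?_, ?_, ?_⟩
  · exact hWZ.symm ▸ le_inf hZA htZ
  · exact (realizes_id (inf_le_right.trans hAS)).mem_conjClass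
  · change A.relIndex (W ⊔ A) = Nat.card (fixedCosets A (W ⊓ A) t)
    rw [hcard', hcard, hWZ]

end FusionSystem

end

/-! ### Assembly of the statements. -/

theorem proposition2p2 {p : ℕ} [Fact p.Prime] {G : Type*} [Group G] {S : Subgroup G} [Finite S]
    (hS : IsPGroup p S) (F : FusionSystem S) (hF : F.IsSaturated p)
    (A : Subgroup G) (hAS : A ≤ S) [IsMulCommutative A] (hA : ¬ F.IsNormal A) :
    F.fusingElements A =
      {t | t ∈ normalizerIn S A ∧ t ∉ A ∧ Subgroup.zpowers t ∈ F.fusingSubgroups A} ∧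
    (F.fusingSubgroups A).Nonempty ∧ (F.fusingElements A).Nonempty ∧
    (F.fusingTriples A).Nonempty ∧
    (¬ F.IsWeaklyClosed A →
      ∃ U ∈ F.conjClass A, U ≠ A ∧ ⁅U, A⁆ ≤ U ⊓ A ∧
        ∀ t ∈ U, t ∉ A → (t, U, U ⊓ A) ∈ F.fusingTriples A) ∧
    (F.IsWeaklyClosed A →
      ∀ t ∈ F.fusingElements A, ∃ U ∈ F.fusingSubgroups A, ∃ B ≤ A,
        (t, U, B) ∈ F.fusingTriples A) ∧
    (F.IsWeaklyClosed A →
      ∃ (Z : Subgroup G) (hZ : Z ≤ S), Z ≤ A ∧ F.IsFullyCentralized Z ∧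
        ¬ (F.centralizer Z hZ).IsNormal A ∧
        (∀ U ∈ (F.centralizer Z hZ).fusingSubgroups A, U ⊓ A ≤ Z) ∧
        (F.centralizer Z hZ).fusingTriples A ⊆ F.fusingTriples A ∧
        ∀ t U B, (t, U, B) ∈ (F.centralizer Z hZ).fusingTriples A → B = U ⊓ A) ∧
    ∃ t ∈ F.fusingElements A, ∃ U ∈ F.fusingSubgroups A, (t, U, U ⊓ A) ∈ F.fusingTriples A := by
  have hT : ∀ t, t ∈ F.fusingElements A ↔
      t ∈ normalizerIn S A ∧ t ∉ A ∧ Subgroup.zpowers t ∈ F.fusingSubgroups A :=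
    fun t => FusionSystem.mem_fusingElements_iff hAS
  have hlast : ∃ t ∈ F.fusingElements A, ∃ U ∈ F.fusingSubgroups A,
      (t, U, U ⊓ A) ∈ F.fusingTriples A := by
    by_cases hW : F.IsWeaklyClosed A
    · obtain ⟨t, ht⟩ := hW.nonempty_fusingElements hS hF hAS hA
      exact hW.exists_fusingTriples_inf hS hF hAS ⟨_, ((hT t).1 ht).2.2⟩
    · obtain ⟨U, ⟨φ, hφ⟩, hUA, -, h⟩ :=
        FusionSystem.exists_fusingTriples_of_not_isWeaklyClosed hS hF hAS hW
      have hUS : U ≤ S := (F.le_of_mem hφ.1).2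
      have : Finite A := Finite.of_injective _ (Subgroup.inclusion_injective hAS)
      -- `U` and `A` have the same finite order and differ, so `U ∖ A` is nonempty.
      obtain ⟨t, htU, htA⟩ := SetLike.not_le_iff_exists.1 fun hle : U ≤ A =>
        hUA (Subgroup.eq_of_le_of_card_ge hle (Nat.card_congr φ.toEquiv).le)
      exact ⟨t, (h t htU htA).1, U, (h t htU htA).2.1, h t htU htA⟩
  obtain ⟨t, ht, U, hU, hw⟩ := id hlast
  refine ⟨Set.ext hT, ⟨U, hU⟩, ⟨t, ht⟩, ⟨_, hw⟩,
    fun hW => FusionSystem.exists_fusingTriples_of_not_isWeaklyClosed hS hF hAS hW,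
    fun hW t ht => hW.exists_fusingTriples hS hF hAS ht, fun hW => ?_, hlast⟩
  obtain ⟨Z, hZ, hZA, hZc, hZne, hmax⟩ := hW.exists_isFullyCentralized_maximal hF hAS ⟨U, hU⟩
  refine ⟨Z, hZ, hZA, hZc, fun hnormal => ?_, hmax,
    FusionSystem.fusingTriples_centralizer_subset, fun t U B h => ?_⟩
  · exact hZne.ne_empty (FusionSystem.fusingSubgroups_eq_empty_of_isNormal hnormal)
  · exact FusionSystem.eq_of_mem_conjClass_centralizer (hmax U h.2.1) h.2.2.2.1
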